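/- There is a universal constant $C>0$ such that the following holds. Let $M,K,R\ge 1$ and $d\ge 0$ be integers, let $\mathcal D_1,\dots,\mathcal D_M$ be probability distributions on a common sample space, and let $f(w;\xi)$, $w\in\mathbb R^d$, be a stochastic objective (measurable in $\xi$ and integrable under every $\mathcal D_m$, for each $w$). Put $F_m(w)=\mathbb E_{\xi\sim\mathcal D_m}f(w;\xi)$ and $F(w)=\frac1M\sum_{m=1}^M F_m(w)$. Assume that $f(\cdot;\xi)$ is convex and $H$-smooth (differentiable with $H$-Lipschitz gradient) for every $\xi$, that $\mathbb E_{\xi\sim\mathcal D_m}[\nabla f(w;\xi)]=\nabla F_m(w)$ for all $m$ and $w$, and that $F_*\in\mathbb R$ satisfies $F(w)\ge F_*$ for all $w$; $F$ need not have a minimizer. Let $u\in\mathbb R^d$ be any comparator, and let $\sigma(u),\zeta(u)\ge 0$ be such that for every $m$ $$\mathbb E_{\xi\sim\mathcal D_m}\|\nabla f(u;\xi)-\nabla F_m(u)\|^2\le\sigma^2(u),\qquad \|\nabla F_m(u)-\nabla F(u)\|\le\zeta(u).$$ Local SGD with initialization $\bar w_0\in\mathbb R^d$ and step size $\eta$ runs,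 for $r=0,\dots,R-1$ and every $m$, $$w_{r,0}^m=\bar w_r,\qquad w_{r,k+1}^m=w_{r,k}^m-\eta\nabla f(w_{r,k}^m;\xi_{r,k}^m)\ \ (0\le k<K),\qquad \bar w_{r+1}=\frac1M\sum_{m=1}^M w_{r,K}^m,$$ with independent samples $\xi_{r,k}^m\sim\mathcal D_m$, and returns $$\hat w=\sum_{r=0}^{R-1}\sum_{k=0}^{K-1}\alpha_{r,k}\,\frac1M\sum_{m=1}^M w_{r,k}^m,\qquad \alpha_{r,k}=\frac{\beta^{Kr+k}}{\sum_{i=0}^{KR-1}\beta^i},\qquad \beta=1-\frac1{KR}$$ (with $0^0=1$). Let $B=\|\bar w_0-u\|$. Then there is a step size $\eta\ge 0$, with $\eta>0$ unless $\bar w_0=u$ and $F(u)=F_*$, for which $F(\hat w)$ is integrable and $$\mathbb E[F(\hat w)-F_*]\le C\left(\frac{HB^2}{R}+\frac{\sigma(u)B}{\sqrt{MKR}}+\frac{(H\sigma^2(u)B^4)^{1/3}}{K^{1/3}R^{2/3}}+\frac{(H\zeta^2(u)B^4)^{1/3}}{R^{2/3}}+R\,(F(u)-F_*)\right).$$ 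-/

import Mathlib

open MeasureTheory ProbabilityTheory
open scoped NNReal

namespace LocalSGD

noncomputable section

universe u

/-- The parameter space `ℝ^d` with its Euclidean norm. -/
abbrev Param (d : ℕ) : Type := EuclideanSpace ℝ (Fin d)

/-- The stochastic gradient `∇ f(w; ξ)`, the gradient being taken in `w`. -/
def stochGrad {d : ℕ} {Ξ : Type u} (f : Param d → Ξ → ℝ) (w : Param d) (x : Ξ) : Param d :=
  gradient (fun v => f v x) w

/-- The objective of client `m`: `F_m(w) = E_{ξ ∼ D_m} f(w; ξ)`. -/
def clientObj {d M : ℕ} {Ξ : Type u} [MeasurableSpace Ξ] (D : Fin M → Measure Ξ)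
    (f : Param d → Ξ → ℝ) (m : Fin M) (w : Param d) : ℝ :=
  ∫ x, f w x ∂(D m)

/-- The global objective: `F(w) = (1/M) ∑ m, F_m(w)`. -/
def globalObj {d M : ℕ} {Ξ : Type u} [MeasurableSpace Ξ] (D : Fin M → Measure Ξ)
    (f : Param d → Ξ → ℝ) (w : Param d) : ℝ :=
  (1 / (M : ℝ)) * ∑ m, clientObj D f m w

/-- The standing assumptions on the stochastic objective: the expectations that define the `F_m`
make sense, every `f(·; ξ)` is convex and `H`-smooth (differentiable with `H`-Lipschitz gradient),
`Fstar` is a lower bound of the global objective (it need be neither attained nor the infimum),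
and the stochastic gradients are unbiased. -/
structure IsConvexSmoothObjective {d M : ℕ} {Ξ : Type u} [MeasurableSpace Ξ]
    (D : Fin M → Measure Ξ) (f : Param d → Ξ → ℝ) (H : ℝ≥0) (Fstar : ℝ) : Prop where
  measurable : ∀ w, Measurable (f w)
  integrable : ∀ m w, Integrable (f w) (D m)
  convex : ∀ x, ConvexOn ℝ Set.univ (fun w => f w x)
  differentiable : ∀ x, Differentiable ℝ (fun w => f w x)
  lipschitz_grad : ∀ x, LipschitzWith H (fun w => stochGrad f w x)
  lower_bound : ∀ w, Fstar ≤ globalObj D f w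
  integrable_grad : ∀ m w, Integrable (stochGrad f w) (D m)
  unbiased : ∀ m w, ∫ x, stochGrad f w x ∂(D m) = gradient (clientObj D f m) w

/-- `σ` bounds the standard deviation of the stochastic gradients of all clients at the
point `u`. -/
def LocalNoise {d M : ℕ} {Ξ : Type u} [MeasurableSpace Ξ] (D : Fin M → Measure Ξ)
    (f : Param d → Ξ → ℝ) (u : Param d) (σ : ℝ) : Prop :=
  0 ≤ σ ∧ ∀ m,
    Integrable (fun x => ‖stochGrad f u x - gradient (clientObj D f m) u‖ ^ 2) (D m) ∧
      ∫ x, ‖stochGrad f u x - gradient (clientObj D f m) u‖ ^ 2 ∂(D m) ≤ σ ^ 2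

/-- `ζ` bounds the heterogeneity of the client objectives at the point `u`. -/
def LocalHeterogeneity {d M : ℕ} {Ξ : Type u} [MeasurableSpace Ξ] (D : Fin M → Measure Ξ)
    (f : Param d → Ξ → ℝ) (u : Param d) (ζ : ℝ) : Prop :=
  0 ≤ ζ ∧ ∀ m, ‖gradient (clientObj D f m) u - gradient (globalObj D f) u‖ ≤ ζ

/-- `k` local steps of one client with step size `η`, started at `w`, along the samples
`x 0, x 1, …`. -/
def localIter {d : ℕ} {Ξ : Type u} (f : Param d → Ξ → ℝ) (η : ℝ) (x : ℕ → Ξ)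
    (w : Param d) : ℕ → Param d
  | 0 => w
  | k + 1 => localIter f η x w k - η • stochGrad f (localIter f η x w k) (x k)

/-- The synchronized iterate `w̄_r` at the start of round `r`, where `x r k m` is the sample that
client `m` uses in local step `k` of round `r`. -/
def syncIter {d M : ℕ} {Ξ : Type u} (f : Param d → Ξ → ℝ) (η : ℝ) (K : ℕ)
    (x : ℕ → ℕ → Fin M → Ξ) (w₀ : Param d) : ℕ → Param d
  | 0 => w₀
  | r + 1 => (1 / (M : ℝ)) •
      ∑ m, localIter f η (fun k => x r k m) (syncIter f η K x w₀ r) K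

/-- The local iterate `w_{r,k}^m`. -/
def clientIter {d M : ℕ} {Ξ : Type u} (f : Param d → Ξ → ℝ) (η : ℝ) (K : ℕ)
    (x : ℕ → ℕ → Fin M → Ξ) (w₀ : Param d) (r k : ℕ) (m : Fin M) : Param d :=
  localIter f η (fun j => x r j m) (syncIter f η K x w₀ r) k

/-- The output of Local SGD after `R` rounds of `K` local steps, with averaging weights `α`:
`ŵ = ∑_{r<R} ∑_{k<K} α_{r,k} (1/M) ∑ m, w_{r,k}^m`. -/
def output {d M : ℕ} {Ξ : Type u} (f : Param d → Ξ → ℝ) (η : ℝ) (K R : ℕ)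
    (α : ℕ → ℕ → ℝ) (x : ℕ → ℕ → Fin M → Ξ) (w₀ : Param d) : Param d :=
  ∑ r ∈ Finset.range R, ∑ k ∈ Finset.range K,
    α r k • ((1 / (M : ℝ)) • ∑ m, clientIter f η K x w₀ r k m)

/-- The averaging weights `α_{r,k} = β^{Kr+k} / ∑_{i<KR} β^i` with `β = 1 - 1/(KR)`. -/
def geomWeight (K R r k : ℕ) : ℝ :=
  (1 - 1 / ((K : ℝ) * R)) ^ (K * r + k) /
    ∑ i ∈ Finset.range (K * R), (1 - 1 / ((K : ℝ) * R)) ^ i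

/-- `ξ r k m`, for `r < R`, `k < K` and `m` a client, are independent random variables on `(Ω, P)`,
and `ξ r k m` has law `D m`. -/
structure IsSampling {M : ℕ} {Ξ : Type u} [MeasurableSpace Ξ] (D : Fin M → Measure Ξ) (K R : ℕ)
    {Ω : Type*} [MeasurableSpace Ω] (P : Measure Ω) (ξ : ℕ → ℕ → Fin M → Ω → Ξ) : Prop where
  measurable : ∀ r < R, ∀ k < K, ∀ m, Measurable (ξ r k m)
  law : ∀ r < R, ∀ k < K, ∀ m, P.map (ξ r k m) = D m
  indep : iIndepFun (fun (i : Fin R × Fin K × Fin M) => ξ i.1 i.2.1 i.2.2) P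

end

end LocalSGD

/-! The argument is the usual one for the squared distance from the averaged iterate to `u`, but it
is run on each realized sample path, with the realized convex smooth functions in place of the
`F_m`. Noise and heterogeneity then enter only through gradients at the fixed point `u`, and moment
bounds at the iterates are not needed beyond square integrability.

The engine is `three_point`. Pairing the gradient at a local iterate with the displacement from `u`
to the average bounds the gap at the average, up to a squared drift, and leaves a co-coercive gain
`s/2 * ‖∇φ(w) - ∇φ(u)‖²`. In `step_inequality` and `drift_inequality` every gradient is split into
its difference from the gradient at `u`, the noise at `u`, and the client mean at `u`. With `s =
6ηK`, admissible when `6ηKH ≤ 1`, the gain pays for all the differences (`round_inequality`).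

On taking expectations, the noises at `u` are independent and centred: averaging over clients gains
a factor `M`, and `k` local steps cost `k` rather than `k²`. The average iterate depends only on
earlier samples, so sampled gaps become gaps of `F` (`integral_comp_of_indep`). Client gradients at
`u` are within `ζ` of `∇F(u)`, and smoothness with the lower bound `Fstar` controls `‖∇F(u)‖²` by
`F(u) - Fstar`; no minimizer is used.

Telescoping the rounds bounds the uniform average of the gaps. The geometric weights are at most
twice uniform, so Jensen carries the bound to the output with `F(u) - Fstar` multiplied by 10 and no
factor `R`; the stated term `R (F(u) - Fstar)` follows from `R ≥ 1`. A balanced step size finishes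
the case `H > 0`, `w₀ ≠ u`; the degenerate cases are treated separately. -/

namespace LocalSGD

/-! ### Inequalities for convex smooth functions -/

section Smooth

variable {E : Type*} [NormedAddCommGroup E] [InnerProductSpace ℝ E] [CompleteSpace E]

theorem hasDerivAt_comp_line {φ : E → ℝ} (hd : Differentiable ℝ φ) (w v : E) (t : ℝ) :
    HasDerivAt (fun t : ℝ => φ (w + t • v)) (inner ℝ (gradient φ (w + t • v)) v) t := by
  have h1 : HasFDerivAt φ _ (w + t • v) := (hd (w + t • v)).hasFDerivAt
  have h2 : HasDerivAt (fun t : ℝ => w + t • v) v t := by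
    simpa using ((hasDerivAt_id t).smul_const v).const_add w
  rw [inner_gradient_left]
  exact h1.comp_hasDerivAt t h2

theorem le_add_inner_gradient_add_sq {φ : E → ℝ} {H : ℝ≥0} (hd : Differentiable ℝ φ)
    (hL : LipschitzWith H (gradient φ)) (v w : E) :
    φ v ≤ φ w + inner ℝ (gradient φ w) (v - w) + H / 2 * ‖v - w‖ ^ 2 := by
  set p := v - w with hp
  let h : ℝ → ℝ := fun t => φ (w + t • p) - t * inner ℝ (gradient φ w) p - H / 2 * ‖p‖ ^ 2 * t ^ 2
  have hder : ∀ t, HasDerivAt h (inner ℝ (gradient φ (w + t • p)) p - inner ℝ (gradient φ w) p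
      - H * ‖p‖ ^ 2 * t) t := by
    intro t
    have h1 := ((hasDerivAt_comp_line hd w p t).sub
      ((hasDerivAt_id t).mul_const (inner ℝ (gradient φ w) p))).sub
      ((hasDerivAt_pow 2 t).const_mul (H / 2 * ‖p‖ ^ 2))
    refine h1.congr_deriv ?_
    simp
    ring
  have hanti : AntitoneOn h (Set.Icc 0 1) := by
    refine antitoneOn_of_deriv_nonpos (convex_Icc 0 1)
      (fun t _ => (hder t).continuousAt.continuousWithinAt)
      (fun t _ => (hder t).differentiableAt.differentiableWithinAt) ?_
    intro t ht
    rw [interior_Icc] at ht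
    rw [(hder t).deriv, ← inner_sub_left]
    have h1 := real_inner_le_norm (gradient φ (w + t • p) - gradient φ w) p
    have h2 := hL.norm_sub_le (w + t • p) w
    rw [add_sub_cancel_left, norm_smul, Real.norm_of_nonneg ht.1.le] at h2
    have h3 := mul_le_mul_of_nonneg_right h2 (norm_nonneg p)
    nlinarith
  have := hanti (Set.left_mem_Icc.2 zero_le_one) (Set.right_mem_Icc.2 zero_le_one) zero_le_one
  simp only [h, one_smul, zero_smul, add_zero, hp, add_sub_cancel] at this
  rw [hp]
  linarith

theorem add_inner_gradient_le {φ : E → ℝ} (hd : Differentiable ℝ φ)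
    (hc : ConvexOn ℝ Set.univ φ) (v w : E) :
    φ w + inner ℝ (gradient φ w) (v - w) ≤ φ v := by
  have hc' : ConvexOn ℝ Set.univ (fun t : ℝ => φ (w + t • (v - w))) := by
    have := hc.comp_affineMap (AffineMap.lineMap w v : ℝ →ᵃ[ℝ] E)
    refine this.congr ?_
    intro t _
    simp [AffineMap.lineMap_apply, add_comm]
  have := hc'.le_slope_of_hasDerivAt (Set.mem_univ (0 : ℝ)) (Set.mem_univ 1) zero_lt_one
    (hasDerivAt_comp_line hd w (v - w) 0)
  simp only [slope_def_field, zero_smul, add_zero, one_smul, add_sub_cancel, sub_zero,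
    div_one] at this
  linarith

/-- At the test point `u - s • p`, with `p` the gradient difference, the tangent plane at `w` lies
below `φ` and the quadratic model at `u` above it; comparing the two gives the gain. A free `s` with
`s * H ≤ 1` replaces `1 / H`, so that `s` can be matched to the step size. -/
theorem half_mul_sq_norm_gradient_sub_le {φ : E → ℝ} {H : ℝ≥0} (hd : Differentiable ℝ φ)
    (hc : ConvexOn ℝ Set.univ φ) (hL : LipschitzWith H (gradient φ)) {s : ℝ} (hs : 0 ≤ s)
    (hsH : s * H ≤ 1) (u w : E) :
    s / 2 * ‖gradient φ w - gradient φ u‖ ^ 2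
      ≤ φ u - φ w - inner ℝ (gradient φ w) (u - w) := by
  set p := gradient φ u - gradient φ w with hp
  have h1 := add_inner_gradient_le hd hc (u - s • p) w
  have h2 := le_add_inner_gradient_add_sq hd hL (u - s • p) u
  have e1 : u - s • p - u = -(s • p) := by abel
  have e2 : u - s • p - w = (u - w) - s • p := by abel
  have e3 : inner ℝ (gradient φ u) p - inner ℝ (gradient φ w) p = ‖p‖ ^ 2 := by
    rw [← inner_sub_left, ← hp, real_inner_self_eq_norm_sq]
  rw [e1, inner_neg_right, inner_smul_right, norm_neg, norm_smul, Real.norm_of_nonneg hs] at h2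
  rw [e2, inner_sub_right, inner_smul_right] at h1
  rw [norm_sub_rev, ← hp]
  have h4 : s * (s * H) * ‖p‖ ^ 2 ≤ s * 1 * ‖p‖ ^ 2 := by gcongr
  have h5 : s * inner ℝ (gradient φ u) p - s * inner ℝ (gradient φ w) p = s * ‖p‖ ^ 2 := by
    rw [← e3]; ring
  nlinarith

/-- The displacement is split at `w`: smoothness handles `x - w`, sharpened convexity handles `u -
w`. This lets the gradient sit at a local iterate `w` while the function value is taken at the
average `x`. -/
theorem three_point {φ : E → ℝ} {H : ℝ≥0} (hd : Differentiable ℝ φ)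
    (hc : ConvexOn ℝ Set.univ φ) (hL : LipschitzWith H (gradient φ)) {s : ℝ} (hs : 0 ≤ s)
    (hsH : s * H ≤ 1) (u w x : E) :
    φ x - φ u - H / 2 * ‖x - w‖ ^ 2 + s / 2 * ‖gradient φ w - gradient φ u‖ ^ 2
      ≤ inner ℝ (gradient φ w) (x - u) := by
  have h1 := half_mul_sq_norm_gradient_sub_le hd hc hL hs hsH u w
  have h2 := le_add_inner_gradient_add_sq hd hL x w
  have h3 : inner ℝ (gradient φ w) (x - u)
      = inner ℝ (gradient φ w) (x - w) - inner ℝ (gradient φ w) (u - w) := by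
    rw [← inner_sub_right]; congr 1; abel
  linarith

end Smooth

/-! ### Averages and squared norms -/

section Averages

variable {E : Type*} [NormedAddCommGroup E] [InnerProductSpace ℝ E] {M : ℕ}

theorem sum_norm_sub_sq_eq (hM : 0 < M) (y : Fin M → E) (z : E) :
    ∑ m, ‖y m - z‖ ^ 2 = ∑ m, ‖(1 / (M : ℝ)) • ∑ i, y i - y m‖ ^ 2
      + M * ‖(1 / (M : ℝ)) • ∑ i, y i - z‖ ^ 2 := by
  have hM' : (M : ℝ) ≠ 0 := by positivity
  set a := (1 / (M : ℝ)) • ∑ i, y i with ha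
  have h0 : ∑ m, (y m - a) = 0 := by
    rw [Finset.sum_sub_distrib, Finset.sum_const, Finset.card_univ, Fintype.card_fin, ha,
      ← Nat.cast_smul_eq_nsmul ℝ, smul_smul, mul_one_div_cancel hM', one_smul, sub_self]
  have h1 : ∀ m, ‖y m - z‖ ^ 2
      = ‖a - y m‖ ^ 2 + 2 * inner ℝ (y m - a) (a - z) + ‖a - z‖ ^ 2 := by
    intro m
    rw [norm_sub_rev a, ← norm_add_sq_real, sub_add_sub_cancel]
  simp_rw [h1, Finset.sum_add_distrib, ← Finset.mul_sum, ← sum_inner, h0]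
  simp

/-- The mean minimizes the sum of squared distances. Hence disagreement among clients is bounded by
their drift from the common starting point. -/
theorem sum_norm_average_sub_sq_le (hM : 0 < M) (y : Fin M → E) (z : E) :
    ∑ m, ‖(1 / (M : ℝ)) • ∑ i, y i - y m‖ ^ 2 ≤ ∑ m, ‖y m - z‖ ^ 2 := by
  rw [sum_norm_sub_sq_eq hM y z]
  have : 0 ≤ (M : ℝ) * ‖(1 / (M : ℝ)) • ∑ i, y i - z‖ ^ 2 := by positivity
  linarith

theorem norm_average_sq_le (hM : 0 < M) (y : Fin M → E) :
    ‖(1 / (M : ℝ)) • ∑ i, y i‖ ^ 2 ≤ 1 / M * ∑ m, ‖y m‖ ^ 2 := by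
  have h := sum_norm_sub_sq_eq hM y 0
  simp only [sub_zero] at h
  have h1 : 0 ≤ ∑ m, ‖(1 / (M : ℝ)) • ∑ i, y i - y m‖ ^ 2 := by positivity
  have hM' : (0 : ℝ) < M := by positivity
  rw [one_div, ← div_eq_inv_mul, le_div_iff₀ hM', mul_comm]
  simp only [one_div] at h h1 ⊢
  linarith

end Averages

section Norms

variable {E : Type*} [NormedAddCommGroup E]

theorem norm_sum_sq_le_card_mul {ι : Type*} (s : Finset ι) (y : ι → E) :
    ‖∑ i ∈ s, y i‖ ^ 2 ≤ s.card * ∑ i ∈ s, ‖y i‖ ^ 2 :=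
  (pow_le_pow_left₀ (norm_nonneg _) (norm_sum_le _ _) 2).trans sq_sum_le_card_mul_sum_sq

theorem norm_add_three_sq_le (a b c : E) :
    ‖a + b + c‖ ^ 2 ≤ 3 * (‖a‖ ^ 2 + ‖b‖ ^ 2 + ‖c‖ ^ 2) := by
  have h := norm_add₃_le (a := a) (b := b) (c := c)
  nlinarith [sq_nonneg (‖a‖ - ‖b‖), sq_nonneg (‖b‖ - ‖c‖), sq_nonneg (‖a‖ - ‖c‖),
    norm_nonneg (a + b + c), norm_nonneg a, norm_nonneg b, norm_nonneg c]

end Norms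

/-! ### One communication round on a fixed sample path -/

section Round

variable {E : Type*} [NormedAddCommGroup E] [InnerProductSpace ℝ E] [CompleteSpace E] {M : ℕ}

/-- Expand the square, use `three_point` for the cross term, and split the averaged gradient into
three parts for the quadratic term. The noise is averaged before its norm is taken, which preserves
the variance reduction by `M`. -/
theorem step_inequality (hM : 0 < M) {φ : Fin M → E → ℝ} {H : ℝ≥0}
    (hd : ∀ m, Differentiable ℝ (φ m)) (hc : ∀ m, ConvexOn ℝ Set.univ (φ m))
    (hL : ∀ m, LipschitzWith H (gradient (φ m))) {s η : ℝ} (hs : 0 ≤ s) (hsH : s * H ≤ 1)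
    (hη : 0 ≤ η) (y a n : Fin M → E) (u x : E)
    (hu : ∀ m, gradient (φ m) u = a m + n m) :
    ‖x - η • ((1 / (M : ℝ)) • ∑ m, gradient (φ m) (y m)) - u‖ ^ 2
        + 2 * η * (1 / M * ∑ m, (φ m x - φ m u))
      ≤ ‖x - u‖ ^ 2 + η * H * (1 / M * ∑ m, ‖x - y m‖ ^ 2)
        + (3 * η ^ 2 - η * s) * (1 / M * ∑ m, ‖gradient (φ m) (y m) - gradient (φ m) u‖ ^ 2)
        + 3 * η ^ 2 * ‖(1 / (M : ℝ)) • ∑ m, n m‖ ^ 2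
        + 3 * η ^ 2 * ‖(1 / (M : ℝ)) • ∑ m, a m‖ ^ 2 := by
  set g := (1 / (M : ℝ)) • ∑ m, gradient (φ m) (y m) with hg
  have hinner : 1 / (M : ℝ) * ∑ m, (φ m x - φ m u)
      - H / 2 * (1 / M * ∑ m, ‖x - y m‖ ^ 2)
      + s / 2 * (1 / M * ∑ m, ‖gradient (φ m) (y m) - gradient (φ m) u‖ ^ 2)
      ≤ inner ℝ g (x - u) := by
    rw [hg, real_inner_smul_left, sum_inner]
    have h1 := Finset.sum_le_sum fun m (_ : m ∈ Finset.univ) =>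
      three_point (hd m) (hc m) (hL m) hs hsH u (y m) x
    rw [Finset.sum_add_distrib, Finset.sum_sub_distrib, ← Finset.mul_sum, ← Finset.mul_sum] at h1
    have h2 := mul_le_mul_of_nonneg_left h1 (by positivity : 0 ≤ 1 / (M : ℝ))
    linarith
  have hnorm : ‖g‖ ^ 2 ≤ 3 * (1 / M * ∑ m, ‖gradient (φ m) (y m) - gradient (φ m) u‖ ^ 2
      + ‖(1 / (M : ℝ)) • ∑ m, n m‖ ^ 2 + ‖(1 / (M : ℝ)) • ∑ m, a m‖ ^ 2) := by
    have hsplit : g = (1 / (M : ℝ)) • ∑ m, (gradient (φ m) (y m) - gradient (φ m) u)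
        + (1 / (M : ℝ)) • ∑ m, n m + (1 / (M : ℝ)) • ∑ m, a m := by
      rw [hg, ← smul_add, ← smul_add, ← Finset.sum_add_distrib, ← Finset.sum_add_distrib]
      congr 1
      refine Finset.sum_congr rfl fun m _ => ?_
      rw [hu m]; abel
    rw [hsplit]
    refine (norm_add_three_sq_le _ _ _).trans ?_
    gcongr
    exact norm_average_sq_le hM _
  have hexp : ‖x - η • g - u‖ ^ 2 = ‖x - u‖ ^ 2 - 2 * (η * inner ℝ g (x - u))
      + η ^ 2 * ‖g‖ ^ 2 := by
    rw [sub_right_comm, norm_sub_sq_real, real_inner_smul_right, norm_smul, mul_pow,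
      Real.norm_eq_abs, sq_abs, real_inner_comm]
  rw [hexp]
  have h1 := mul_le_mul_of_nonneg_left hinner hη
  have h2 := mul_le_mul_of_nonneg_left hnorm (sq_nonneg η)
  linarith

/-- The drift of one client from its starting point. -/
theorem drift_inequality {φ : ℕ → E → ℝ} {η : ℝ} {y n : ℕ → E} {a u : E}
    (hy : ∀ k, y (k + 1) = y k - η • gradient (φ k) (y k))
    (hu : ∀ k, gradient (φ k) u = a + n k) (k : ℕ) :
    ‖y k - y 0‖ ^ 2 ≤ 3 * η ^ 2 *
      (k * ∑ j ∈ Finset.range k, ‖gradient (φ j) (y j) - gradient (φ j) u‖ ^ 2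
        + ‖∑ j ∈ Finset.range k, n j‖ ^ 2 + k ^ 2 * ‖a‖ ^ 2) := by
  -- The noise stays a single sum inside the norm: independence will make its second moment grow
  -- like `k`, whereas a termwise bound would give `k ^ 2`.
  have hsum : ∀ k, y k - y 0 = -(η • (∑ j ∈ Finset.range k,
      (gradient (φ j) (y j) - gradient (φ j) u) + ∑ j ∈ Finset.range k, n j + (k : ℝ) • a)) := by
    intro k
    induction k with
    | zero => simp
    | succ k ih =>
      have h1 : y (k + 1) - y 0 = (y k - y 0)
          - η • ((gradient (φ k) (y k) - gradient (φ k) u) + n k + a) := by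
        rw [hy k, hu k]
        module
      rw [h1, ih, Finset.sum_range_succ, Finset.sum_range_succ]
      push_cast
      module
  rw [hsum k, norm_neg, norm_smul, mul_pow, Real.norm_eq_abs, sq_abs, mul_comm 3, mul_assoc]
  refine mul_le_mul_of_nonneg_left ((norm_add_three_sq_le _ _ _).trans ?_) (sq_nonneg η)
  gcongr
  · simpa using norm_sum_sq_le_card_mul (Finset.range k)
      fun j => gradient (φ j) (y j) - gradient (φ j) u
  · rw [norm_smul, mul_pow]; simp

/-- One communication round, along a fixed realization of the samples. -/
theorem round_inequality (hM : 0 < M) {K : ℕ} (hK : 0 < K) {φ : Fin M → ℕ → E → ℝ} {H : ℝ≥0}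
    (hd : ∀ m k, Differentiable ℝ (φ m k)) (hc : ∀ m k, ConvexOn ℝ Set.univ (φ m k))
    (hL : ∀ m k, LipschitzWith H (gradient (φ m k))) {η : ℝ} (hη : 0 ≤ η)
    (hηH : 6 * (η * K) * H ≤ 1) {y n : Fin M → ℕ → E} {a : Fin M → E} {u z : E}
    (hy0 : ∀ m, y m 0 = z) (hy : ∀ m k, y m (k + 1) = y m k - η • gradient (φ m k) (y m k))
    (hu : ∀ m k, gradient (φ m k) u = a m + n m k) :
    ‖(1 / (M : ℝ)) • ∑ m, y m K - u‖ ^ 2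
        + 2 * η * ∑ k ∈ Finset.range K,
          1 / M * ∑ m, (φ m k ((1 / (M : ℝ)) • ∑ i, y i k) - φ m k u)
      ≤ ‖z - u‖ ^ 2 + 3 * η ^ 2 * ∑ k ∈ Finset.range K, ‖(1 / (M : ℝ)) • ∑ m, n m k‖ ^ 2
        + 3 * η ^ 2 * K * ‖(1 / (M : ℝ)) • ∑ m, a m‖ ^ 2
        + 3 * η ^ 3 * H * ∑ k ∈ Finset.range K,
            1 / M * ∑ m, ‖∑ j ∈ Finset.range k, n m j‖ ^ 2
        + 3 * η ^ 3 * H * K ^ 3 * (1 / M * ∑ m, ‖a m‖ ^ 2) := by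
  have hM' : (M : ℝ) ≠ 0 := by positivity
  have hK1 : (1 : ℝ) ≤ K := by exact_mod_cast hK
  set x : ℕ → E := fun k => (1 / (M : ℝ)) • ∑ m, y m k with hx
  set e : ℕ → ℝ := fun k => 1 / M * ∑ m, ‖gradient (φ m k) (y m k) - gradient (φ m k) u‖ ^ 2
    with he
  have he0 : ∀ k, 0 ≤ e k := fun k => by positivity
  set A : ℝ := 1 / M * ∑ m, ‖a m‖ ^ 2 with hA
  have hA0 : 0 ≤ A := by positivity
  set N : ℕ → ℝ := fun k => 1 / M * ∑ m, ‖∑ j ∈ Finset.range k, n m j‖ ^ 2 with hN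
  have hx0 : x 0 = z := by
    simp only [hx, hy0, Finset.sum_const, Finset.card_univ, Fintype.card_fin]
    rw [← Nat.cast_smul_eq_nsmul ℝ, smul_smul, one_div_mul_cancel hM', one_smul]
  have hx1 : ∀ k, x (k + 1) = x k - η • ((1 / (M : ℝ)) • ∑ m, gradient (φ m k) (y m k)) := by
    intro k
    simp only [hx, hy, Finset.sum_sub_distrib, ← Finset.smul_sum, smul_sub]
    rw [smul_comm]
  have hcons : ∀ k < K, 1 / M * ∑ m, ‖x k - y m k‖ ^ 2
      ≤ 3 * η ^ 2 * (K * ∑ j ∈ Finset.range K, e j + N k + K ^ 2 * A) := by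
    intro k hk
    have hkK : (k : ℝ) ≤ K := by exact_mod_cast hk.le
    have h1 := (sum_norm_average_sub_sq_le hM (fun m => y m k) z).trans
      (Finset.sum_le_sum fun m (_ : m ∈ Finset.univ) => by
        simpa only [hy0] using drift_inequality (hy m) (hu m) k)
    rw [← Finset.mul_sum, Finset.sum_add_distrib, Finset.sum_add_distrib, ← Finset.mul_sum,
      ← Finset.mul_sum, Finset.sum_comm] at h1
    have h2 := mul_le_mul_of_nonneg_left h1 (by positivity : 0 ≤ 1 / (M : ℝ))
    have h3 : ∑ j ∈ Finset.range k, e j ≤ ∑ j ∈ Finset.range K, e j :=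
      Finset.sum_le_sum_of_subset_of_nonneg (Finset.range_mono hk.le) fun j _ _ => he0 j
    have h4 : (k : ℝ) * ∑ j ∈ Finset.range k, e j ≤ K * ∑ j ∈ Finset.range K, e j :=
      mul_le_mul hkK h3 (Finset.sum_nonneg fun j _ => he0 j) (by positivity)
    have h5 : (k : ℝ) ^ 2 * A ≤ K ^ 2 * A := by gcongr
    have h6 : 3 * η ^ 2 * (k * ∑ j ∈ Finset.range k, e j + N k + k ^ 2 * A)
        ≤ 3 * η ^ 2 * (K * ∑ j ∈ Finset.range K, e j + N k + K ^ 2 * A) := by gcongr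
    refine (h2.trans (le_of_eq ?_)).trans h6
    simp only [he, hN, hA, ← Finset.mul_sum]
    ring
  have hstep : ∀ k < K, ‖x (k + 1) - u‖ ^ 2
      + 2 * η * (1 / M * ∑ m, (φ m k (x k) - φ m k u))
      ≤ ‖x k - u‖ ^ 2
        + η * H * (3 * η ^ 2 * (K * ∑ j ∈ Finset.range K, e j + N k + K ^ 2 * A))
        + (3 * η ^ 2 - η * (6 * (η * K))) * e k
        + 3 * η ^ 2 * ‖(1 / (M : ℝ)) • ∑ m, n m k‖ ^ 2
        + 3 * η ^ 2 * ‖(1 / (M : ℝ)) • ∑ m, a m‖ ^ 2 := by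
    intro k hk
    -- Here `s = 6 * (η * K)`, for which `s * H ≤ 1` is exactly `hηH`.
    have h1 := step_inequality hM (fun m => hd m k) (fun m => hc m k) (fun m => hL m k)
      (by positivity : 0 ≤ 6 * (η * K)) hηH hη (fun m => y m k) a (fun m => n m k) u (x k)
      (fun m => hu m k)
    rw [hx1 k]
    have h2 := mul_le_mul_of_nonneg_left (hcons k hk) (by positivity : 0 ≤ η * H)
    linarith
  -- The drift bound contains the sum of `e` over the whole round, so it is the same at every step
  -- and appears `L` times.
  have htel : ∀ L ≤ K, ‖x L - u‖ ^ 2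
      + 2 * η * ∑ k ∈ Finset.range L, 1 / M * ∑ m, (φ m k (x k) - φ m k u)
      ≤ ‖z - u‖ ^ 2
        + L * (3 * η ^ 3 * H * (K * ∑ j ∈ Finset.range K, e j + K ^ 2 * A))
        + 3 * η ^ 3 * H * ∑ k ∈ Finset.range L, N k
        + (3 * η ^ 2 - η * (6 * (η * K))) * ∑ k ∈ Finset.range L, e k
        + 3 * η ^ 2 * ∑ k ∈ Finset.range L, ‖(1 / (M : ℝ)) • ∑ m, n m k‖ ^ 2
        + 3 * η ^ 2 * L * ‖(1 / (M : ℝ)) • ∑ m, a m‖ ^ 2 := by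
    intro L
    induction L with
    | zero => intro _; simp [hx0]
    | succ L ih =>
      intro hL'
      have h1 := ih (by omega)
      have h2 := hstep L (by omega)
      simp only [Finset.sum_range_succ _ L]
      push_cast
      linarith
  have hfin := htel K le_rfl
  -- The drift costs at most `η ^ 2 * K / 2` by `hηH`, the quadratic term at most `3 * η ^ 2 * K`
  -- since `1 ≤ K`; the gain `6 * η ^ 2 * K` exceeds their sum.
  have habs : (3 * η ^ 3 * H * K ^ 2 + (3 * η ^ 2 - η * (6 * (η * K))))
      * ∑ j ∈ Finset.range K, e j ≤ 0 := by
    refine mul_nonpos_of_nonpos_of_nonneg ?_ (Finset.sum_nonneg fun j _ => he0 j)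
    have h1 : η ^ 2 * K * (6 * (η * K) * H) ≤ η ^ 2 * K * 1 := by gcongr
    have h2 : η ^ 2 * 1 ≤ η ^ 2 * K := by gcongr
    have h3 := sq_nonneg η
    linarith
  linarith

end Round

universe v

/-! ### Regularity of the client and global objectives -/

section Objective

variable {d M : ℕ} {Ξ : Type v} [MeasurableSpace Ξ] {D : Fin M → Measure Ξ} {f : Param d → Ξ → ℝ} {H : ℝ≥0} {Fstar : ℝ}

theorem IsConvexSmoothObjective.integral_linearization
    (h : IsConvexSmoothObjective D f H Fstar) (m : Fin M) (v w : Param d) :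
    Integrable (fun x => f w x + inner ℝ (stochGrad f w x) (v - w)) (D m) ∧
    ∫ x, (f w x + inner ℝ (stochGrad f w x) (v - w)) ∂(D m)
      = clientObj D f m w + inner ℝ (gradient (clientObj D f m) w) (v - w) := by
  have hi : Integrable (fun x => inner ℝ (stochGrad f w x) (v - w)) (D m) :=
    (h.integrable_grad m w).inner_const _
  refine ⟨(h.integrable m w).add hi, ?_⟩
  rw [integral_add (h.integrable m w) hi, ← h.unbiased m w]
  simp_rw [real_inner_comm (v - w)]
  rw [integral_inner (h.integrable_grad m w), clientObj]

theorem IsConvexSmoothObjective.clientObj_add_inner_le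
    (h : IsConvexSmoothObjective D f H Fstar) (m : Fin M) (v w : Param d) :
    clientObj D f m w + inner ℝ (gradient (clientObj D f m) w) (v - w) ≤ clientObj D f m v := by
  obtain ⟨h1, h2⟩ := h.integral_linearization m v w
  rw [← h2]
  exact integral_mono h1 (h.integrable m v) fun x =>
    add_inner_gradient_le (h.differentiable x) (h.convex x) v w

theorem IsConvexSmoothObjective.measurable_uncurry
    (h : IsConvexSmoothObjective D f H Fstar) : Measurable (Function.uncurry f) :=
  measurable_uncurry_of_continuous_of_measurable (fun x => (h.differentiable x).continuous)
    h.measurable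

/-- Each coordinate is a pointwise limit of difference quotients, which are measurable in the
sample. -/
theorem IsConvexSmoothObjective.measurable_stochGrad
    (h : IsConvexSmoothObjective D f H Fstar) (w : Param d) : Measurable (stochGrad f w) := by
  have hcoord : ∀ i : Fin d, Measurable fun x => stochGrad f w x i := by
    intro i
    set b : Param d := EuclideanSpace.single i 1 with hb
    have hlim : ∀ x, Filter.Tendsto
        (fun n : ℕ => ((n : ℝ) + 1) * (f (w + ((n : ℝ) + 1)⁻¹ • b) x - f w x)) Filter.atTop
        (nhds (stochGrad f w x i)) := by
      intro x
      have h1 := hasDerivAt_comp_line (h.differentiable x) w b 0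
      have h2 := h1.tendsto_slope
      have h3 : Filter.Tendsto (fun n : ℕ => ((n : ℝ) + 1)⁻¹) Filter.atTop
          (nhdsWithin (0 : ℝ) {0}ᶜ) := by
        refine tendsto_nhdsWithin_iff.2 ⟨?_, Filter.Eventually.of_forall fun n => ?_⟩
        · simpa using tendsto_one_div_add_atTop_nhds_zero_nat (𝕜 := ℝ)
        · simp only [Set.mem_compl_iff, Set.mem_singleton_iff]
          positivity
      have h4 := h2.comp h3
      have h5 : inner ℝ (gradient (fun v => f v x) (w + (0 : ℝ) • b)) b = stochGrad f w x i := by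
        rw [zero_smul, add_zero, hb, EuclideanSpace.inner_single_right]
        simp [stochGrad]
      rw [h5] at h4
      refine h4.congr fun n => ?_
      simp [slope_def_field, div_eq_mul_inv, mul_comm]
    refine measurable_of_tendsto_metrizable (fun n => ?_) (tendsto_pi_nhds.2 hlim)
    exact ((h.measurable _).sub (h.measurable _)).const_mul _
  have h1 : Measurable fun x => WithLp.toLp 2 (fun i => stochGrad f w x i) :=
    (WithLp.measurable_toLp 2 _).comp (measurable_pi_lambda _ hcoord)
  exact h1

theorem IsConvexSmoothObjective.measurable_uncurry_stochGrad
    (h : IsConvexSmoothObjective D f H Fstar) : Measurable (Function.uncurry (stochGrad f)) :=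
  measurable_uncurry_of_continuous_of_measurable (fun x => (h.lipschitz_grad x).continuous)
    h.measurable_stochGrad

variable [∀ m, IsProbabilityMeasure (D m)]

theorem IsConvexSmoothObjective.clientObj_le
    (h : IsConvexSmoothObjective D f H Fstar) (m : Fin M) (v w : Param d) :
    clientObj D f m v ≤ clientObj D f m w + inner ℝ (gradient (clientObj D f m) w) (v - w)
      + H / 2 * ‖v - w‖ ^ 2 := by
  obtain ⟨h1, h2⟩ := h.integral_linearization m v w
  have h3 : ∫ x, (f w x + inner ℝ (stochGrad f w x) (v - w) + H / 2 * ‖v - w‖ ^ 2) ∂(D m)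
      = clientObj D f m w + inner ℝ (gradient (clientObj D f m) w) (v - w)
        + H / 2 * ‖v - w‖ ^ 2 := by
    rw [integral_add h1 (integrable_const _), h2, integral_const]
    simp
  rw [← h3]
  exact integral_mono (h.integrable m v) (h1.add (integrable_const _)) fun x =>
    le_add_inner_gradient_add_sq (h.differentiable x) (h.lipschitz_grad x) v w

/-- Unbiasedness alone does not give differentiability, since `gradient` is zero by default where
there is none. But the integrated tangent and quadratic bounds trap the objective within `O(‖v -
w‖²)` of an affine function. -/
theorem IsConvexSmoothObjective.hasGradientAt_clientObj
    (h : IsConvexSmoothObjective D f H Fstar) (m : Fin M) (w : Param d) :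
    HasGradientAt (clientObj D f m) (gradient (clientObj D f m) w) w := by
  rw [hasGradientAt_iff_isLittleO]
  have h1 : (fun v => clientObj D f m v - clientObj D f m w
      - inner ℝ (gradient (clientObj D f m) w) (v - w)) =O[nhds w] fun v => ‖v - w‖ ^ 2 := by
    refine Asymptotics.IsBigO.of_bound (H / 2) (Filter.Eventually.of_forall fun v => ?_)
    have h2 := h.clientObj_add_inner_le m v w
    have h3 := h.clientObj_le m v w
    rw [Real.norm_of_nonneg (by linarith), Real.norm_of_nonneg (by positivity)]
    linarith
  refine h1.trans_isLittleO ?_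
  have h4 : (fun v : Param d => ‖v - w‖ ^ 2) =o[nhds w] fun v => ‖v - w‖ ^ 1 := by
    refine (Asymptotics.isLittleO_pow_pow one_lt_two).comp_tendsto ?_
    have : Filter.Tendsto (fun v => ‖v - w‖) (nhds w) (nhds ‖w - w‖) :=
      ((continuous_id.sub continuous_const).norm).tendsto w
    simpa using this
  simpa using h4

theorem IsConvexSmoothObjective.hasGradientAt_globalObj
    (h : IsConvexSmoothObjective D f H Fstar) (w : Param d) :
    HasGradientAt (globalObj D f) ((1 / (M : ℝ)) • ∑ m, gradient (clientObj D f m) w) w := by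
  rw [hasGradientAt_iff_hasFDerivAt, map_smul, map_sum]
  exact (HasFDerivAt.fun_sum fun m _ =>
    (hasGradientAt_iff_hasFDerivAt.1 (h.hasGradientAt_clientObj m w))).const_mul _

theorem IsConvexSmoothObjective.gradient_globalObj
    (h : IsConvexSmoothObjective D f H Fstar) (w : Param d) :
    gradient (globalObj D f) w = (1 / (M : ℝ)) • ∑ m, gradient (clientObj D f m) w :=
  (h.hasGradientAt_globalObj w).gradient

theorem IsConvexSmoothObjective.differentiable_globalObj
    (h : IsConvexSmoothObjective D f H Fstar) : Differentiable ℝ (globalObj D f) :=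
  fun w => (h.hasGradientAt_globalObj w).differentiableAt

theorem IsConvexSmoothObjective.globalObj_add_inner_le
    (h : IsConvexSmoothObjective D f H Fstar) (v w : Param d) :
    globalObj D f w + inner ℝ (gradient (globalObj D f) w) (v - w) ≤ globalObj D f v := by
  rw [h.gradient_globalObj, real_inner_smul_left, sum_inner, globalObj, globalObj, ← mul_add,
    ← Finset.sum_add_distrib]
  gcongr with m
  exact h.clientObj_add_inner_le m v w

theorem IsConvexSmoothObjective.globalObj_le (hM : 0 < M)
    (h : IsConvexSmoothObjective D f H Fstar) (v w : Param d) :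
    globalObj D f v ≤ globalObj D f w + inner ℝ (gradient (globalObj D f) w) (v - w)
      + H / 2 * ‖v - w‖ ^ 2 := by
  have hM' : (M : ℝ) ≠ 0 := by positivity
  have h1 : H / 2 * ‖v - w‖ ^ 2 = 1 / (M : ℝ) * ∑ _m : Fin M, (H / 2 * ‖v - w‖ ^ 2) := by
    rw [Finset.sum_const, Finset.card_univ, Fintype.card_fin, nsmul_eq_mul]
    field_simp
  rw [h.gradient_globalObj, real_inner_smul_left, sum_inner, globalObj, globalObj, h1, ← mul_add,
    ← Finset.sum_add_distrib, ← mul_add, ← Finset.sum_add_distrib]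
  gcongr with m
  exact h.clientObj_le m v w

theorem IsConvexSmoothObjective.convexOn_globalObj
    (h : IsConvexSmoothObjective D f H Fstar) : ConvexOn ℝ Set.univ (globalObj D f) := by
  refine ⟨convex_univ, fun x _ y _ a b ha hb hab => ?_⟩
  set z := a • x + b • y
  have h1 := mul_le_mul_of_nonneg_left (h.globalObj_add_inner_le x z) ha
  have h2 := mul_le_mul_of_nonneg_left (h.globalObj_add_inner_le y z) hb
  have h3 : a * inner ℝ (gradient (globalObj D f) z) (x - z)
      + b * inner ℝ (gradient (globalObj D f) z) (y - z) = 0 := by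
    rw [← real_inner_smul_right, ← real_inner_smul_right, ← inner_add_right, smul_sub, smul_sub,
      sub_add_sub_comm, ← add_smul, hab, one_smul, sub_self, inner_zero_right]
  have h4 : a * globalObj D f z + b * globalObj D f z = globalObj D f z := by
    rw [← add_mul, hab, one_mul]
  simp only [smul_eq_mul]
  linarith

/-- A gradient step of length `t` lowers the objective by at least `t / 2 * ‖g‖ ^ 2`, and it cannot
fall below `Fstar`. -/
theorem IsConvexSmoothObjective.mul_norm_gradient_sq_le (hM : 0 < M)
    (h : IsConvexSmoothObjective D f H Fstar) {t : ℝ} (ht : 0 ≤ t) (htH : t * H ≤ 1)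
    (w : Param d) :
    t * ‖gradient (globalObj D f) w‖ ^ 2 ≤ 2 * (globalObj D f w - Fstar) := by
  set g := gradient (globalObj D f) w with hg
  have h1 := (h.lower_bound (w - t • g)).trans (h.globalObj_le hM (w - t • g) w)
  have e1 : w - t • g - w = -(t • g) := by abel
  rw [e1, ← hg, inner_neg_right, inner_smul_right, norm_neg, norm_smul, Real.norm_of_nonneg ht,
    real_inner_self_eq_norm_sq] at h1
  have h2 : t * (t * H) * ‖g‖ ^ 2 ≤ t * 1 * ‖g‖ ^ 2 := by gcongr
  nlinarith

theorem IsConvexSmoothObjective.globalObj_eq_of_smoothness_zero (hM : 0 < M)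
    (h : IsConvexSmoothObjective D f 0 Fstar) (v w : Param d) :
    globalObj D f v = globalObj D f w := by
  have hg : gradient (globalObj D f) w = 0 := by
    by_contra hne
    have hpos : 0 < ‖gradient (globalObj D f) w‖ ^ 2 := by positivity
    have h0 := h.lower_bound w
    -- With `H = 0` every `t ≥ 0` is admissible; this one makes the left side exceed the right by 1.
    have h1 := h.mul_norm_gradient_sq_le hM
      (t := (2 * (globalObj D f w - Fstar) + 1) / ‖gradient (globalObj D f) w‖ ^ 2)
      (div_nonneg (by linarith) hpos.le) (by simp) w
    rw [div_mul_cancel₀ _ hpos.ne'] at h1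
    linarith
  have h1 := h.globalObj_add_inner_le v w
  have h2 := h.globalObj_le hM v w
  simp only [hg, inner_zero_left, NNReal.coe_zero, zero_div, zero_mul, add_zero] at h1 h2
  exact le_antisymm h2 h1

end Objective

/-! ### Measurability of the iterates -/

section Iterates

variable {d M : ℕ} {Ξ : Type v} [MeasurableSpace Ξ] {Ω : Type*} {f : Param d → Ξ → ℝ}

theorem measurable_localIter [MeasurableSpace Ω]
    (hf : Measurable (Function.uncurry (stochGrad f))) (η : ℝ) {x : ℕ → Ω → Ξ} {w : Ω → Param d}
    (hw : Measurable w) {k : ℕ} (hx : ∀ j < k, Measurable (x j)) :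
    Measurable fun ω => localIter f η (fun j => x j ω) (w ω) k := by
  induction k with
  | zero => exact hw
  | succ k ih =>
    have h1 := ih fun j hj => hx j (by omega)
    exact h1.sub ((hf.comp (h1.prodMk (hx k (by omega)))).const_smul η)

theorem measurable_syncIter [MeasurableSpace Ω]
    (hf : Measurable (Function.uncurry (stochGrad f))) (η : ℝ) (K : ℕ)
    {x : ℕ → ℕ → Fin M → Ω → Ξ} (w₀ : Param d) {r : ℕ}
    (hx : ∀ i < r, ∀ k < K, ∀ m, Measurable (x i k m)) :
    Measurable fun ω => syncIter f η K (fun r k m => x r k m ω) w₀ r := by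
  induction r with
  | zero => exact measurable_const
  | succ r ih =>
    have h1 := ih fun i hi => hx i (by omega)
    exact (Finset.measurable_sum _ fun m _ =>
      measurable_localIter hf η h1 fun j hj => hx r (by omega) j hj m).const_smul (1 / (M : ℝ))

theorem measurable_clientIter [MeasurableSpace Ω]
    (hf : Measurable (Function.uncurry (stochGrad f))) (η : ℝ) (K : ℕ)
    {x : ℕ → ℕ → Fin M → Ω → Ξ} (w₀ : Param d) {r k : ℕ}
    (hx : ∀ i < r, ∀ k < K, ∀ m, Measurable (x i k m))
    (hx' : ∀ j < k, ∀ m, Measurable (x r j m)) (m : Fin M) :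
    Measurable fun ω => clientIter f η K (fun r k m => x r k m ω) w₀ r k m :=
  measurable_localIter hf η (measurable_syncIter hf η K w₀ hx) fun j hj => hx' j hj m

end Iterates

/-! ### Orthogonality of independent centred vectors -/

section Noise

theorem integral_norm_sum_sq_eq {Ω ι E : Type*} [MeasurableSpace Ω] {P : Measure Ω}
    [IsFiniteMeasure P] [NormedAddCommGroup E] [InnerProductSpace ℝ E] [CompleteSpace E] [MeasurableSpace E]
    [BorelSpace E] {Y : ι → Ω → E} {s : Finset ι} (hY : ∀ i ∈ s, MemLp (Y i) 2 P)
    (h0 : ∀ i ∈ s, ∫ ω, Y i ω ∂P = 0)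
    (hind : ∀ i ∈ s, ∀ j ∈ s, i ≠ j → IndepFun (Y i) (Y j) P) :
    ∫ ω, ‖∑ i ∈ s, Y i ω‖ ^ 2 ∂P = ∑ i ∈ s, ∫ ω, ‖Y i ω‖ ^ 2 ∂P := by
  have hint : ∀ i ∈ s, ∀ j ∈ s, Integrable (fun ω => inner ℝ (Y i ω) (Y j ω)) P := by
    intro i hi j hj
    refine ((((hY i hi).integrable_norm_pow two_ne_zero)).add
      ((hY j hj).integrable_norm_pow two_ne_zero)).mono'
      ((hY i hi).1.inner (hY j hj).1) (Filter.Eventually.of_forall fun ω => ?_)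
    have h1 := norm_inner_le_norm (𝕜 := ℝ) (Y i ω) (Y j ω)
    simp only [Pi.add_apply]
    nlinarith [sq_nonneg (‖Y i ω‖ - ‖Y j ω‖), norm_nonneg (Y i ω), norm_nonneg (Y j ω)]
  have hexp : ∀ ω, ‖∑ i ∈ s, Y i ω‖ ^ 2 = ∑ i ∈ s, ∑ j ∈ s, inner ℝ (Y i ω) (Y j ω) := by
    intro ω
    rw [← real_inner_self_eq_norm_sq, sum_inner]
    simp_rw [inner_sum]
  simp_rw [hexp]
  rw [integral_finsetSum _ fun i hi => integrable_finsetSum _ fun j hj => hint i hi j hj]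
  refine Finset.sum_congr rfl fun i hi => ?_
  rw [integral_finsetSum _ fun j hj => hint i hi j hj, Finset.sum_eq_single_of_mem i hi]
  · simp_rw [real_inner_self_eq_norm_sq]
  · intro j hj hji
    have h1 := (hind i hi j hj hji.symm).integral_bilin ((hY i hi).integrable one_le_two)
      ((hY j hj).integrable one_le_two) (innerSL ℝ : E →L[ℝ] E →L[ℝ] ℝ)
    rw [h0 i hi, map_zero, zero_apply] at h1
    exact h1

end Noise

/-- The information generated by the samples that are drawn before local step `k` of round `r`. -/
@[reducible]
def pastSigma {M : ℕ} {Ξ : Type v} [MeasurableSpace Ξ] (K R : ℕ) {Ω : Type*}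
    (ξ : ℕ → ℕ → Fin M → Ω → Ξ) (r k : ℕ) : MeasurableSpace Ω :=
  ⨆ i ∈ {i : Fin R × Fin K × Fin M | (i.1 : ℕ) < r ∨ (i.1 : ℕ) = r ∧ (i.2.1 : ℕ) < k},
    MeasurableSpace.comap (ξ i.1 i.2.1 i.2.2) inferInstance

theorem measurable_pastSigma {M K R : ℕ} {Ξ : Type v} [MeasurableSpace Ξ] {Ω : Type*}
    {ξ : ℕ → ℕ → Fin M → Ω → Ξ} {r k i j : ℕ} (hi : i < R) (hj : j < K) (m : Fin M)
    (h : i < r ∨ i = r ∧ j < k) : Measurable[pastSigma K R ξ r k] (ξ i j m) := by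
  have h1 : MeasurableSpace.comap (ξ i j m) inferInstance ≤ pastSigma K R ξ r k :=
    le_iSup₂_of_le (f := fun (i : Fin R × Fin K × Fin M) (_ : i ∈ {i : Fin R × Fin K × Fin M |
      (i.1 : ℕ) < r ∨ (i.1 : ℕ) = r ∧ (i.2.1 : ℕ) < k}) =>
      MeasurableSpace.comap (ξ i.1 i.2.1 i.2.2) inferInstance) (⟨i, hi⟩, ⟨j, hj⟩, m) h le_rfl
  exact (comap_measurable (ξ i j m)).mono h1 le_rfl

/-! ### Independence, moments of the noise, and sampled objectives -/

section Sampling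

variable {M K R : ℕ} {Ξ : Type v} [MeasurableSpace Ξ] {D : Fin M → Measure Ξ}
  {Ω : Type*} [MeasurableSpace Ω] {P : Measure Ω} {ξ : ℕ → ℕ → Fin M → Ω → Ξ}

theorem IsSampling.pastSigma_le (hξ : IsSampling D K R P ξ) (r k : ℕ) :
    pastSigma K R ξ r k ≤ ‹MeasurableSpace Ω› :=
  iSup₂_le fun i _ => (hξ.measurable _ i.1.2 _ i.2.1.2 i.2.2).comap_le

theorem IsSampling.indepFun_of_measurable_pastSigma (hξ : IsSampling D K R P ξ) {r k : ℕ}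
    (hr : r < R) (hk : k < K) (m : Fin M) {β : Type*} [MeasurableSpace β] {X : Ω → β}
    (hX : Measurable[pastSigma K R ξ r k] X) : IndepFun X (ξ r k m) P := by
  have h1 := indep_iSup_of_disjoint
    (fun i : Fin R × Fin K × Fin M => (hξ.measurable _ i.1.2 _ i.2.1.2 i.2.2).comap_le) hξ.indep
    (S := {i : Fin R × Fin K × Fin M | (i.1 : ℕ) < r ∨ (i.1 : ℕ) = r ∧ (i.2.1 : ℕ) < k})
    (T := {(⟨r, hr⟩, ⟨k, hk⟩, m)}) (by
      rw [Set.disjoint_singleton_right]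
      simp)
  rw [iSup_singleton] at h1
  exact indep_of_indep_of_le_left h1 hX.comap_le

theorem IsSampling.indepFun_of_ne (hξ : IsSampling D K R P ξ) {r k r' k' : ℕ} (hr : r < R)
    (hk : k < K) (hr' : r' < R) (hk' : k' < K) (m m' : Fin M)
    (hne : (r, k, m) ≠ (r', k', m')) : IndepFun (ξ r k m) (ξ r' k' m') P :=
  hξ.indep.indepFun (i := (⟨r, hr⟩, ⟨k, hk⟩, m)) (j := (⟨r', hr'⟩, ⟨k', hk'⟩, m'))
    (by simpa using hne)

variable {d : ℕ} {f : Param d → Ξ → ℝ} {H : ℝ≥0} {Fstar : ℝ} {u : Param d} {σ : ℝ}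

/-- The noise of a stochastic gradient at the comparator. -/
noncomputable def gradNoise (D : Fin M → Measure Ξ) (f : Param d → Ξ → ℝ) (u : Param d) (m : Fin M) (x : Ξ) :
    Param d :=
  stochGrad f u x - gradient (clientObj D f m) u

theorem IsConvexSmoothObjective.measurable_gradNoise (h : IsConvexSmoothObjective D f H Fstar)
    (m : Fin M) : Measurable (gradNoise D f u m) :=
  (h.measurable_stochGrad u).sub_const _

theorem IsSampling.memLp_gradNoise (hξ : IsSampling D K R P ξ)
    (h : IsConvexSmoothObjective D f H Fstar) (hσ : LocalNoise D f u σ) {r k : ℕ} (hr : r < R)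
    (hk : k < K) (m : Fin M) : MemLp (fun ω => gradNoise D f u m (ξ r k m ω)) 2 P := by
  have hm := hξ.measurable r hr k hk m
  have h1 : MemLp (gradNoise D f u m) 2 (D m) :=
    (memLp_two_iff_integrable_sq_norm (h.measurable_gradNoise m).aestronglyMeasurable).2
      (hσ.2 m).1
  rw [← hξ.law r hr k hk m] at h1
  exact h1.comp_of_map hm.aemeasurable

theorem IsSampling.integral_gradNoise_sq_le (hξ : IsSampling D K R P ξ)
    (h : IsConvexSmoothObjective D f H Fstar) (hσ : LocalNoise D f u σ) {r k : ℕ} (hr : r < R)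
    (hk : k < K) (m : Fin M) : ∫ ω, ‖gradNoise D f u m (ξ r k m ω)‖ ^ 2 ∂P ≤ σ ^ 2 := by
  have hm := hξ.measurable r hr k hk m
  have h1 := integral_map (μ := P) hm.aemeasurable (f := fun x => ‖gradNoise D f u m x‖ ^ 2)
    ((h.measurable_gradNoise m).norm.pow_const 2).aestronglyMeasurable
  rw [← h1, hξ.law r hr k hk m]
  exact (hσ.2 m).2

theorem IsSampling.integral_gradNoise (hξ : IsSampling D K R P ξ)
    [∀ m, IsProbabilityMeasure (D m)]
    (h : IsConvexSmoothObjective D f H Fstar) {r k : ℕ} (hr : r < R)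
    (hk : k < K) (m : Fin M) : ∫ ω, gradNoise D f u m (ξ r k m ω) ∂P = 0 := by
  have hm := hξ.measurable r hr k hk m
  have h1 := integral_map (μ := P) hm.aemeasurable (f := gradNoise D f u m)
    (h.measurable_gradNoise m).aestronglyMeasurable
  rw [← h1, hξ.law r hr k hk m]
  simp only [gradNoise]
  rw [integral_sub (h.integrable_grad m u) (integrable_const _), h.unbiased m u]
  simp

theorem IsSampling.indepFun_gradNoise (hξ : IsSampling D K R P ξ)
    (h : IsConvexSmoothObjective D f H Fstar) {r k r' k' : ℕ} (hr : r < R)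
    (hk : k < K) (hr' : r' < R) (hk' : k' < K) (m m' : Fin M)
    (hne : (r, k, m) ≠ (r', k', m')) :
    IndepFun (fun ω => gradNoise D f u m (ξ r k m ω))
      (fun ω => gradNoise D f u m' (ξ r' k' m' ω)) P :=
  (hξ.indepFun_of_ne hr hk hr' hk' m m' hne).comp (h.measurable_gradNoise m)
    (h.measurable_gradNoise m')

theorem IsSampling.integral_norm_average_gradNoise_sq_le [IsProbabilityMeasure P]
    [∀ m, IsProbabilityMeasure (D m)] (hM : 0 < M) (hξ : IsSampling D K R P ξ)
    (h : IsConvexSmoothObjective D f H Fstar) (hσ : LocalNoise D f u σ) {r k : ℕ} (hr : r < R)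
    (hk : k < K) :
    ∫ ω, ‖(1 / (M : ℝ)) • ∑ m, gradNoise D f u m (ξ r k m ω)‖ ^ 2 ∂P ≤ σ ^ 2 / M := by
  have hM' : (M : ℝ) ≠ 0 := by positivity
  have h1 := integral_norm_sum_sq_eq (P := P) (s := Finset.univ)
    (Y := fun m ω => gradNoise D f u m (ξ r k m ω))
    (fun m _ => hξ.memLp_gradNoise h hσ hr hk m) (fun m _ => hξ.integral_gradNoise h hr hk m)
    (fun m _ m' _ hne => hξ.indepFun_gradNoise h hr hk hr hk m m' (by simpa using hne))
  have h2 : ∑ m : Fin M, ∫ ω, ‖gradNoise D f u m (ξ r k m ω)‖ ^ 2 ∂P ≤ M * σ ^ 2 := by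
    have := Finset.sum_le_sum fun m (_ : m ∈ (Finset.univ : Finset (Fin M))) =>
      hξ.integral_gradNoise_sq_le h hσ hr hk m
    simpa using this
  simp_rw [norm_smul, mul_pow]
  rw [integral_const_mul, h1, Real.norm_of_nonneg (by positivity)]
  calc (1 / (M : ℝ)) ^ 2 * _ ≤ (1 / (M : ℝ)) ^ 2 * (M * σ ^ 2) := by gcongr
    _ = σ ^ 2 / M := by field_simp

theorem IsSampling.integral_norm_sum_gradNoise_sq_le [IsProbabilityMeasure P]
    [∀ m, IsProbabilityMeasure (D m)] (hξ : IsSampling D K R P ξ)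
    (h : IsConvexSmoothObjective D f H Fstar) (hσ : LocalNoise D f u σ) {r k : ℕ} (hr : r < R)
    (hk : k < K) (m : Fin M) :
    ∫ ω, ‖∑ j ∈ Finset.range k, gradNoise D f u m (ξ r j m ω)‖ ^ 2 ∂P ≤ K * σ ^ 2 := by
  have hj : ∀ j ∈ Finset.range k, j < K := fun j hj => (Finset.mem_range.1 hj).trans hk
  rw [integral_norm_sum_sq_eq (P := P) (s := Finset.range k)
    (Y := fun j ω => gradNoise D f u m (ξ r j m ω))
    (fun j h' => hξ.memLp_gradNoise h hσ hr (hj j h') m)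
    (fun j h' => hξ.integral_gradNoise h hr (hj j h') m)
    (fun j h' j' h'' hne => hξ.indepFun_gradNoise h hr (hj j h') hr (hj j' h'') m m
      (by simpa using hne))]
  have h1 := Finset.sum_le_sum fun j h' => hξ.integral_gradNoise_sq_le h hσ hr (hj j h') m
  rw [Finset.sum_const, Finset.card_range, nsmul_eq_mul] at h1
  refine h1.trans ?_
  gcongr

/-- Second moments are assumed only at `u`; the Lipschitz gradient transfers them to any
square-integrable point. This drives the induction showing that all iterates are square integrable.
-/
theorem IsConvexSmoothObjective.memLp_stochGrad_comp [IsProbabilityMeasure P]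
    (h : IsConvexSmoothObjective D f H Fstar) (hσ : LocalNoise D f u σ)
    (hξ : IsSampling D K R P ξ) {r k : ℕ} (hr : r < R) (hk : k < K) (m : Fin M)
    {X : Ω → Param d} (hX : MemLp X 2 P) :
    MemLp (fun ω => stochGrad f (X ω) (ξ r k m ω)) 2 P := by
  have hn := (hξ.memLp_gradNoise h hσ hr hk m).norm
  have hb : MemLp (fun ω => ‖gradNoise D f u m (ξ r k m ω)‖ + ‖gradient (clientObj D f m) u‖
      + H * ‖X ω - u‖) 2 P :=
    (hn.add (memLp_const _)).add (((hX.sub (memLp_const u)).norm).const_mul (H : ℝ))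
  refine hb.mono' ?_ (Filter.Eventually.of_forall fun ω => ?_)
  · exact (h.measurable_uncurry_stochGrad.comp_aemeasurable
      (hX.1.aemeasurable.prodMk (hξ.measurable r hr k hk m).aemeasurable)).aestronglyMeasurable
  · have h1 := (h.lipschitz_grad (ξ r k m ω)).norm_sub_le (X ω) u
    have h2 : stochGrad f (X ω) (ξ r k m ω) = gradNoise D f u m (ξ r k m ω)
        + gradient (clientObj D f m) u
        + (stochGrad f (X ω) (ξ r k m ω) - stochGrad f u (ξ r k m ω)) := by
      rw [gradNoise]; abel
    calc ‖stochGrad f (X ω) (ξ r k m ω)‖ ≤ _ := (congrArg norm h2).le.trans norm_add₃_le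
      _ ≤ _ := by gcongr

theorem IsConvexSmoothObjective.integrable_comp [IsProbabilityMeasure P]
    (h : IsConvexSmoothObjective D f H Fstar) (hσ : LocalNoise D f u σ)
    (hξ : IsSampling D K R P ξ) {r k : ℕ} (hr : r < R) (hk : k < K) (m : Fin M)
    {X : Ω → Param d} (hX : MemLp X 2 P) :
    Integrable (fun ω => f (X ω) (ξ r k m ω)) P := by
  have hm := hξ.measurable r hr k hk m
  have hu : Integrable (fun ω => f u (ξ r k m ω)) P := by
    have := h.integrable m u
    rw [← hξ.law r hr k hk m] at this
    exact this.comp_measurable hm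
  have hg := h.memLp_stochGrad_comp hσ hξ hr hk m (memLp_const u)
  have hXu : MemLp (fun ω => X ω - u) 2 P := hX.sub (memLp_const u)
  have hb : Integrable (fun ω => ‖f u (ξ r k m ω)‖ + ‖stochGrad f u (ξ r k m ω)‖ ^ 2
      + (1 + H / 2) * ‖X ω - u‖ ^ 2) P :=
    (hu.norm.add (hg.integrable_norm_pow two_ne_zero)).add
      ((hXu.integrable_norm_pow two_ne_zero).const_mul _)
  refine hb.mono' ?_ (Filter.Eventually.of_forall fun ω => ?_)
  · exact (h.measurable_uncurry.comp_aemeasurable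
      (hX.1.aemeasurable.prodMk hm.aemeasurable)).aestronglyMeasurable
  · set x := ξ r k m ω
    have h1 : f u x + inner ℝ (stochGrad f u x) (X ω - u) ≤ f (X ω) x :=
      add_inner_gradient_le (h.differentiable x) (h.convex x) (X ω) u
    have h2 : f (X ω) x ≤ f u x + inner ℝ (stochGrad f u x) (X ω - u)
        + H / 2 * ‖X ω - u‖ ^ 2 :=
      le_add_inner_gradient_add_sq (h.differentiable x) (h.lipschitz_grad x) (X ω) u
    have h3 := abs_le.1 (abs_real_inner_le_norm (stochGrad f u x) (X ω - u))
    have h4 := abs_le.1 (le_refl |f u x|)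
    have h5 : 0 ≤ (H : ℝ) / 2 * ‖X ω - u‖ ^ 2 := by positivity
    have h6 : ‖stochGrad f u x‖ * ‖X ω - u‖ ≤ ‖stochGrad f u x‖ ^ 2 + ‖X ω - u‖ ^ 2 := by
      nlinarith [sq_nonneg (‖stochGrad f u x‖ - ‖X ω - u‖), norm_nonneg (stochGrad f u x),
        norm_nonneg (X ω - u)]
    rw [Real.norm_eq_abs, Real.norm_eq_abs, abs_le]
    constructor <;> linarith

/-- The point depends on the past only, so the joint law with the fresh sample is a product and
Fubini integrates the sample out first. -/
theorem IsConvexSmoothObjective.integral_comp_of_indep [IsProbabilityMeasure P]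
    [∀ m, IsProbabilityMeasure (D m)]
    (h : IsConvexSmoothObjective D f H Fstar) (hσ : LocalNoise D f u σ)
    (hξ : IsSampling D K R P ξ) {r k : ℕ} (hr : r < R) (hk : k < K) (m : Fin M)
    {X : Ω → Param d} (hX : MemLp X 2 P) (hXm : Measurable[pastSigma K R ξ r k] X) :
    Integrable (fun ω => clientObj D f m (X ω)) P ∧
      ∫ ω, f (X ω) (ξ r k m ω) ∂P = ∫ ω, clientObj D f m (X ω) ∂P := by
  have hm := hξ.measurable r hr k hk m
  have hXm' : Measurable X := hXm.mono (hξ.pastSigma_le r k) le_rfl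
  have hmap : P.map (fun ω => (X ω, ξ r k m ω)) = (P.map X).prod (D m) := by
    rw [← hξ.law r hr k hk m]
    exact (hξ.indepFun_of_measurable_pastSigma hr hk m hXm).map_prod_eq_prod_map_map
      hXm'.aemeasurable hm.aemeasurable
  have hpair : Measurable fun ω => (X ω, ξ r k m ω) := hXm'.prodMk hm
  have hprob : IsProbabilityMeasure (P.map X) := Measure.isProbabilityMeasure_map hXm'.aemeasurable
  have hint : Integrable (Function.uncurry f) ((P.map X).prod (D m)) := by
    rw [← hmap]
    exact (integrable_map_measure h.measurable_uncurry.aestronglyMeasurable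
      hpair.aemeasurable).2 (h.integrable_comp hσ hξ hr hk m hX)
  have hint' : Integrable (clientObj D f m) (P.map X) := hint.integral_prod_left
  refine ⟨hint'.comp_measurable hXm', ?_⟩
  have h1 := integral_map (μ := P) hpair.aemeasurable (f := Function.uncurry f)
    h.measurable_uncurry.aestronglyMeasurable
  have h2 := integral_map (μ := P) hXm'.aemeasurable hint'.1
  rw [hmap, integral_prod _ hint] at h1
  exact h1.symm.trans h2

end Sampling

/-- The average over the clients of the local iterates `w_{r,k}^m`. -/
noncomputable def averageIter {d M : ℕ} {Ξ : Type v} (f : Param d → Ξ → ℝ) (η : ℝ) (K : ℕ)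
    (x : ℕ → ℕ → Fin M → Ξ) (w₀ : Param d) (r k : ℕ) : Param d :=
  (1 / (M : ℝ)) • ∑ m, clientIter f η K x w₀ r k m

theorem measurable_averageIter {d M K R : ℕ} {Ξ : Type v} [MeasurableSpace Ξ]
    {D : Fin M → Measure Ξ} {Ω : Type*} {ξ : ℕ → ℕ → Fin M → Ω → Ξ} {f : Param d → Ξ → ℝ}
    {H : ℝ≥0} {Fstar : ℝ} (h : IsConvexSmoothObjective D f H Fstar) (η : ℝ)
    (w₀ : Param d) {r k : ℕ} (hr : r < R) (hk : k < K) :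
    Measurable[pastSigma K R ξ r k]
      fun ω => averageIter f η K (fun r k m => ξ r k m ω) w₀ r k := by
  have h1 : ∀ m, Measurable[pastSigma K R ξ r k]
      fun ω => clientIter f η K (fun r k m => ξ r k m ω) w₀ r k m := fun m =>
    -- The past σ-algebra is passed in place of the ambient one; iterate `(r, k)` uses only samples
    -- strictly before `(r, k)`.
    @measurable_clientIter d M Ξ _ Ω f (pastSigma K R ξ r k) h.measurable_uncurry_stochGrad η K
      ξ w₀ r k (fun i hi j hj m' => measurable_pastSigma (hi.trans hr) hj m' (Or.inl hi))
      (fun j hj m' => measurable_pastSigma hr (hj.trans hk) m' (Or.inr ⟨rfl, hj⟩)) m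
  exact (Finset.measurable_sum _ fun m _ => h1 m).const_smul (1 / (M : ℝ))

/-! ### Expected progress over one round and over all rounds -/

section Expectation

variable {d M K R : ℕ} {Ξ : Type v} [MeasurableSpace Ξ] {D : Fin M → Measure Ξ}
  {Ω : Type*} [MeasurableSpace Ω] {P : Measure Ω} [IsProbabilityMeasure P]
  {ξ : ℕ → ℕ → Fin M → Ω → Ξ} {f : Param d → Ξ → ℝ} {H : ℝ≥0} {Fstar : ℝ}
  {u : Param d} {σ ζ : ℝ}

theorem memLp_localIter (h : IsConvexSmoothObjective D f H Fstar) (hσ : LocalNoise D f u σ)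
    (hξ : IsSampling D K R P ξ) (η : ℝ) {w : Ω → Param d} (hw : MemLp w 2 P) {r k : ℕ}
    (hr : r < R) (hk : k ≤ K) (m : Fin M) :
    MemLp (fun ω => localIter f η (fun j => ξ r j m ω) (w ω) k) 2 P := by
  induction k with
  | zero => exact hw
  | succ k ih =>
    have h1 := ih (by omega)
    exact h1.sub ((h.memLp_stochGrad_comp hσ hξ hr hk m h1).const_smul η)

theorem memLp_syncIter (h : IsConvexSmoothObjective D f H Fstar) (hσ : LocalNoise D f u σ)
    (hξ : IsSampling D K R P ξ) (η : ℝ) (w₀ : Param d) {r : ℕ} (hr : r ≤ R) :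
    MemLp (fun ω => syncIter f η K (fun r k m => ξ r k m ω) w₀ r) 2 P := by
  induction r with
  | zero => exact memLp_const _
  | succ r ih =>
    exact (memLp_finsetSum _ fun m _ =>
      memLp_localIter h hσ hξ η (ih (by omega)) hr le_rfl m).const_smul (1 / (M : ℝ))

theorem memLp_averageIter (h : IsConvexSmoothObjective D f H Fstar) (hσ : LocalNoise D f u σ)
    (hξ : IsSampling D K R P ξ) (η : ℝ) (w₀ : Param d) {r k : ℕ} (hr : r < R) (hk : k ≤ K) :
    MemLp (fun ω => averageIter f η K (fun r k m => ξ r k m ω) w₀ r k) 2 P :=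
  (memLp_finsetSum _ fun m _ =>
      memLp_localIter h hσ hξ η (memLp_syncIter h hσ hξ η w₀ hr.le) hr hk m).const_smul
    (1 / (M : ℝ))

variable [∀ m, IsProbabilityMeasure (D m)]

theorem integral_average_comp_sub (h : IsConvexSmoothObjective D f H Fstar)
    (hσ : LocalNoise D f u σ) (hξ : IsSampling D K R P ξ) {r k : ℕ} (hr : r < R) (hk : k < K)
    {X : Ω → Param d} (hX : MemLp X 2 P) (hXm : Measurable[pastSigma K R ξ r k] X) :
    Integrable (fun ω => 1 / (M : ℝ) * ∑ m, (f (X ω) (ξ r k m ω) - f u (ξ r k m ω))) P ∧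
    Integrable (fun ω => globalObj D f (X ω)) P ∧
    ∫ ω, 1 / (M : ℝ) * ∑ m, (f (X ω) (ξ r k m ω) - f u (ξ r k m ω)) ∂P
      = ∫ ω, (globalObj D f (X ω) - globalObj D f u) ∂P := by
  have hi : ∀ m, Integrable (fun ω => f (X ω) (ξ r k m ω)) P := fun m =>
    h.integrable_comp hσ hξ hr hk m hX
  have hiu : ∀ m, Integrable (fun ω => f u (ξ r k m ω)) P := fun m =>
    h.integrable_comp hσ hξ hr hk m (memLp_const u)
  have hE := fun m => h.integral_comp_of_indep hσ hξ hr hk m hX hXm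
  have hEu := fun m => h.integral_comp_of_indep hσ hξ hr hk m (memLp_const u) measurable_const
  have hF : Integrable (fun ω => globalObj D f (X ω)) P :=
    (integrable_finsetSum _ fun m _ => (hE m).1).const_mul _
  have hs : ∀ m, Integrable (fun ω => f (X ω) (ξ r k m ω) - f u (ξ r k m ω)) P := fun m =>
    (hi m).sub (hiu m)
  refine ⟨(integrable_finsetSum _ fun m _ => hs m).const_mul _, hF, ?_⟩
  rw [integral_const_mul, integral_finsetSum _ fun m _ => hs m,
    integral_sub hF (integrable_const _)]
  simp only [globalObj]
  rw [integral_const_mul, integral_finsetSum _ fun m _ => (hE m).1, integral_const, probReal_univ,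
    one_smul, ← mul_sub, ← Finset.sum_sub_distrib]
  congr 1
  refine Finset.sum_congr rfl fun m _ => ?_
  rw [integral_sub (hi m) (hiu m), (hE m).2, (hEu m).2, integral_const, probReal_univ, one_smul]

theorem expected_round_inequality (hM : 0 < M) (hK : 0 < K)
    (h : IsConvexSmoothObjective D f H Fstar) (hσ : LocalNoise D f u σ)
    (hζ : LocalHeterogeneity D f u ζ) (hξ : IsSampling D K R P ξ) {η : ℝ} (hη : 0 ≤ η)
    (hηH : 6 * (η * K) * H ≤ 1) (w₀ : Param d) {r : ℕ} (hr : r < R) :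
    ∫ ω, ‖syncIter f η K (fun r k m => ξ r k m ω) w₀ (r + 1) - u‖ ^ 2 ∂P
        + 2 * η * ∑ k ∈ Finset.range K,
          ∫ ω, (globalObj D f (averageIter f η K (fun r k m => ξ r k m ω) w₀ r k)
            - globalObj D f u) ∂P
      ≤ ∫ ω, ‖syncIter f η K (fun r k m => ξ r k m ω) w₀ r - u‖ ^ 2 ∂P
        + 3 * η ^ 2 * (K * (σ ^ 2 / M))
        + 3 * η ^ 2 * K * ‖gradient (globalObj D f) u‖ ^ 2
        + 3 * η ^ 3 * H * (K * (K * σ ^ 2))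
        + 3 * η ^ 3 * H * K ^ 3 * (2 * ζ ^ 2 + 2 * ‖gradient (globalObj D f) u‖ ^ 2) := by
  have hM' : (M : ℝ) ≠ 0 := by positivity
  set G := gradient (globalObj D f) u with hG
  set a : Fin M → Param d := fun m => gradient (clientObj D f m) u with ha
  have haG : (1 / (M : ℝ)) • ∑ m, a m = G := by rw [hG, h.gradient_globalObj]
  -- Heterogeneity enters here and only here.
  have haN : 1 / (M : ℝ) * ∑ m, ‖a m‖ ^ 2 ≤ 2 * ζ ^ 2 + 2 * ‖G‖ ^ 2 := by
    have h1 : ∀ m, ‖a m‖ ^ 2 ≤ 2 * ζ ^ 2 + 2 * ‖G‖ ^ 2 := by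
      intro m
      have h2 : ‖a m - G‖ ≤ ζ := hζ.2 m
      have h3 : ‖a m‖ ≤ ‖a m - G‖ + ‖G‖ := by
        simpa using norm_add_le (a m - G) G
      have h4 : ‖a m‖ ^ 2 ≤ (ζ + ‖G‖) ^ 2 := by gcongr; linarith
      nlinarith [sq_nonneg (ζ - ‖G‖)]
    have h2 := Finset.sum_le_sum fun m (_ : m ∈ (Finset.univ : Finset (Fin M))) => h1 m
    rw [Finset.sum_const, Finset.card_univ, Fintype.card_fin, nsmul_eq_mul] at h2
    calc 1 / (M : ℝ) * ∑ m, ‖a m‖ ^ 2 ≤ 1 / (M : ℝ) * (M * (2 * ζ ^ 2 + 2 * ‖G‖ ^ 2)) := by gcongr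
      _ = _ := by field_simp
  let S : ℕ → Ω → Param d := fun r ω => syncIter f η K (fun r k m => ξ r k m ω) w₀ r
  let X : ℕ → Ω → Param d := fun k ω => averageIter f η K (fun r k m => ξ r k m ω) w₀ r k
  let n : Fin M → ℕ → Ω → Param d := fun m k ω => gradNoise D f u m (ξ r k m ω)
  have hpath : ∀ ω, ‖S (r + 1) ω - u‖ ^ 2 + 2 * η * ∑ k ∈ Finset.range K,
        1 / (M : ℝ) * ∑ m, (f (X k ω) (ξ r k m ω) - f u (ξ r k m ω))
      ≤ ‖S r ω - u‖ ^ 2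
        + 3 * η ^ 2 * ∑ k ∈ Finset.range K, ‖(1 / (M : ℝ)) • ∑ m, n m k ω‖ ^ 2
        + 3 * η ^ 2 * K * ‖G‖ ^ 2
        + 3 * η ^ 3 * H * ∑ k ∈ Finset.range K,
            1 / (M : ℝ) * ∑ m, ‖∑ j ∈ Finset.range k, n m j ω‖ ^ 2
        + 3 * η ^ 3 * H * K ^ 3 * (1 / M * ∑ m, ‖a m‖ ^ 2) := by
    intro ω
    rw [← haG]
    exact round_inequality hM hK (φ := fun m k w => f w (ξ r k m ω))
      (fun m k => h.differentiable _) (fun m k => h.convex _) (fun m k => h.lipschitz_grad _)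
      hη hηH (y := fun m k => clientIter f η K (fun r k m => ξ r k m ω) w₀ r k m)
      (n := fun m k => n m k ω) (a := a) (u := u) (z := S r ω) (fun m => rfl)
      (fun m k => rfl) (fun m k => (add_sub_cancel _ _).symm)
  have hS : ∀ i ≤ R, Integrable (fun ω => ‖S i ω - u‖ ^ 2) P := fun i hi =>
    ((memLp_syncIter h hσ hξ η w₀ hi).sub (memLp_const u)).integrable_norm_pow two_ne_zero
  have hf : ∀ k ∈ Finset.range K, _ := fun k hk =>
    integral_average_comp_sub h hσ hξ hr (Finset.mem_range.1 hk)
      (memLp_averageIter h hσ hξ η w₀ hr (Finset.mem_range.1 hk).le)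
      (measurable_averageIter h η w₀ hr (Finset.mem_range.1 hk))
  have hn1 : ∀ k ∈ Finset.range K,
      Integrable (fun ω => ‖(1 / (M : ℝ)) • ∑ m, n m k ω‖ ^ 2) P := fun k hk =>
    ((memLp_finsetSum _ fun m _ => hξ.memLp_gradNoise h hσ hr
      (Finset.mem_range.1 hk) m).const_smul (1 / (M : ℝ))).integrable_norm_pow two_ne_zero
  have hn2 : ∀ k ∈ Finset.range K, ∀ m,
      Integrable (fun ω => ‖∑ j ∈ Finset.range k, n m j ω‖ ^ 2) P := fun k hk m =>
    (memLp_finsetSum _ fun j hj => hξ.memLp_gradNoise h hσ hr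
      ((Finset.mem_range.1 hj).trans (Finset.mem_range.1 hk)) m).integrable_norm_pow two_ne_zero
  have hn3 : ∀ k ∈ Finset.range K, Integrable (fun ω =>
      1 / (M : ℝ) * ∑ m, ‖∑ j ∈ Finset.range k, n m j ω‖ ^ 2) P := fun k hk =>
    (integrable_finsetSum _ fun m _ => hn2 k hk m).const_mul _
  have i1 := (integrable_finsetSum _ fun k hk => (hf k hk).1).const_mul (2 * η)
  have i2 := (integrable_finsetSum _ hn1).const_mul (3 * η ^ 2)
  have i3 := (integrable_finsetSum _ hn3).const_mul (3 * η ^ 3 * H)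
  have c1 : Integrable (fun _ : Ω => 3 * η ^ 2 * K * ‖G‖ ^ 2) P := integrable_const _
  have c2 : Integrable (fun _ : Ω => 3 * η ^ 3 * H * K ^ 3 * (1 / M * ∑ m, ‖a m‖ ^ 2)) P :=
    integrable_const _
  have hint := integral_mono ((hS (r + 1) hr).add i1)
    (((((hS r hr.le).add i2).add c1).add i3).add c2) hpath
  rw [integral_add' (hS (r + 1) hr) i1, integral_add' ((((hS r hr.le).add i2).add c1).add i3) c2,
    integral_add' (((hS r hr.le).add i2).add c1) i3, integral_add' ((hS r hr.le).add i2) c1,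
    integral_add' (hS r hr.le) i2, integral_const_mul, integral_const_mul, integral_const_mul,
    integral_const_mul,
    integral_finsetSum _ fun k hk => (hf k hk).1, integral_finsetSum _ hn1,
    integral_finsetSum _ hn3, Finset.sum_congr rfl fun k hk => (hf k hk).2.2] at hint
  simp only [integral_const, probReal_univ, one_smul] at hint
  have b1 : ∑ k ∈ Finset.range K, ∫ ω, ‖(1 / (M : ℝ)) • ∑ m, n m k ω‖ ^ 2 ∂P
      ≤ K * (σ ^ 2 / M) := by
    have := Finset.sum_le_sum fun k (hk : k ∈ Finset.range K) =>
      hξ.integral_norm_average_gradNoise_sq_le hM h hσ hr (Finset.mem_range.1 hk)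
    simpa using this
  have b2 : ∑ k ∈ Finset.range K,
      ∫ ω, 1 / (M : ℝ) * ∑ m, ‖∑ j ∈ Finset.range k, n m j ω‖ ^ 2 ∂P ≤ K * (K * σ ^ 2) := by
    have h1 : ∀ k ∈ Finset.range K,
        ∫ ω, 1 / (M : ℝ) * ∑ m, ‖∑ j ∈ Finset.range k, n m j ω‖ ^ 2 ∂P ≤ K * σ ^ 2 := by
      intro k hk
      rw [integral_const_mul, integral_finsetSum _ fun m _ => hn2 k hk m]
      have h2 := Finset.sum_le_sum fun m (_ : m ∈ (Finset.univ : Finset (Fin M))) =>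
        hξ.integral_norm_sum_gradNoise_sq_le h hσ hr (Finset.mem_range.1 hk) m
      rw [Finset.sum_const, Finset.card_univ, Fintype.card_fin, nsmul_eq_mul] at h2
      calc _ ≤ 1 / (M : ℝ) * (M * (K * σ ^ 2)) := by gcongr
        _ = _ := by field_simp
    have := Finset.sum_le_sum h1
    simpa using this
  have b1' := mul_le_mul_of_nonneg_left b1 (by positivity : 0 ≤ 3 * η ^ 2)
  have b2' := mul_le_mul_of_nonneg_left b2 (by positivity : 0 ≤ 3 * η ^ 3 * H)
  have b3' := mul_le_mul_of_nonneg_left haN (by positivity : 0 ≤ 3 * η ^ 3 * H * K ^ 3)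
  linarith

theorem expected_total_inequality (hM : 0 < M) (hK : 0 < K)
    (h : IsConvexSmoothObjective D f H Fstar) (hσ : LocalNoise D f u σ)
    (hζ : LocalHeterogeneity D f u ζ) (hξ : IsSampling D K R P ξ) {η : ℝ} (hη : 0 ≤ η)
    (hηH : 6 * (η * K) * H ≤ 1) (w₀ : Param d) :
    2 * η * ∑ r ∈ Finset.range R, ∑ k ∈ Finset.range K,
          ∫ ω, (globalObj D f (averageIter f η K (fun r k m => ξ r k m ω) w₀ r k)
            - globalObj D f u) ∂P
      ≤ ‖w₀ - u‖ ^ 2 + 2 * η * (K * R) * (3 / 2 * (η * (σ ^ 2 / M))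
          + 3 / 2 * (η ^ 2 * (H * K * σ ^ 2)) + 3 * (η ^ 2 * (H * K ^ 2 * ζ ^ 2))
          + 4 * (globalObj D f u - Fstar)) := by
  have hK1 : (1 : ℝ) ≤ K := by exact_mod_cast hK
  set G := gradient (globalObj D f) u with hG
  set Δ := globalObj D f u - Fstar with hΔ
  -- Two test lengths are needed: `η` for the gradient term of the averaged steps, `η * K` for that
  -- of the local drift.
  have hG1 : η * ‖G‖ ^ 2 ≤ 2 * Δ := by
    refine h.mul_norm_gradient_sq_le hM hη ?_ u
    have : η * 1 * H ≤ η * K * H := by gcongr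
    nlinarith [mul_nonneg hη H.coe_nonneg]
  have hG2 : η * K * ‖G‖ ^ 2 ≤ 2 * Δ := by
    refine h.mul_norm_gradient_sq_le hM (by positivity) ?_ u
    have : 0 ≤ η * K * H := by positivity
    linarith
  have hnon : ∀ r, 0 ≤ ∫ ω, ‖syncIter f η K (fun r k m => ξ r k m ω) w₀ r - u‖ ^ 2 ∂P :=
    fun r => integral_nonneg fun ω => by positivity
  have htel : ∀ L ≤ R, ∫ ω, ‖syncIter f η K (fun r k m => ξ r k m ω) w₀ L - u‖ ^ 2 ∂P
      + 2 * η * ∑ r ∈ Finset.range L, ∑ k ∈ Finset.range K,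
          ∫ ω, (globalObj D f (averageIter f η K (fun r k m => ξ r k m ω) w₀ r k)
            - globalObj D f u) ∂P
      ≤ ‖w₀ - u‖ ^ 2 + L * (3 * η ^ 2 * (K * (σ ^ 2 / M))
        + 3 * η ^ 2 * K * ‖G‖ ^ 2 + 3 * η ^ 3 * H * (K * (K * σ ^ 2))
        + 3 * η ^ 3 * H * K ^ 3 * (2 * ζ ^ 2 + 2 * ‖G‖ ^ 2)) := by
    intro L
    induction L with
    | zero => intro _; simp [syncIter]
    | succ L ih =>
      intro hL
      have h1 := ih (by omega)
      have h2 := expected_round_inequality hM hK h hσ hζ hξ hη hηH w₀ (r := L) (by omega)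
      rw [Finset.sum_range_succ]
      push_cast
      linarith
  have h1 := htel R le_rfl
  have h2 := hnon R
  have h3 : 3 * η ^ 2 * K * ‖G‖ ^ 2 + 3 * η ^ 3 * H * K ^ 3 * (2 * ‖G‖ ^ 2)
      ≤ 2 * η * K * (4 * Δ) := by
    have e1 : 3 * η ^ 2 * K * ‖G‖ ^ 2 = 3 * (η * K) * (η * ‖G‖ ^ 2) := by ring
    have e2 : 3 * η ^ 3 * H * K ^ 3 * (2 * ‖G‖ ^ 2)
        = (η * K) * ((6 * (η * K) * H) * (η * K * ‖G‖ ^ 2)) := by ring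
    have i1 : 3 * (η * K) * (η * ‖G‖ ^ 2) ≤ 3 * (η * K) * (2 * Δ) := by gcongr
    have i2 : (6 * (η * K) * H) * (η * K * ‖G‖ ^ 2) ≤ 1 * (2 * Δ) :=
      mul_le_mul hηH hG2 (by positivity) zero_le_one
    have i3 := mul_le_mul_of_nonneg_left i2 (by positivity : 0 ≤ η * K)
    linarith
  have h4 := mul_le_mul_of_nonneg_left h3 (Nat.cast_nonneg (α := ℝ) R)
  linarith

end Expectation

/-! ### The geometric averaging weights -/

section Weights

variable {K R : ℕ}

theorem geomRatio_nonneg (hK : 0 < K) (hR : 0 < R) : 0 ≤ 1 - 1 / ((K : ℝ) * R) := by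
  have h1 : (1 : ℝ) ≤ K * R := by exact_mod_cast Nat.mul_pos hK hR
  rw [sub_nonneg, div_le_one (by linarith)]
  exact h1

theorem half_mul_le_geom_sum (hK : 0 < K) (hR : 0 < R) :
    (K : ℝ) * R / 2 ≤ ∑ i ∈ Finset.range (K * R), (1 - 1 / ((K : ℝ) * R)) ^ i := by
  have hT : (0 : ℝ) < K * R := by positivity
  have h1 := geom_sum_mul (1 - 1 / ((K : ℝ) * R)) (K * R)
  -- With `T = K * R`, `(1 - 1 / T) ^ T ≤ exp (-1) ≤ 1 / 2`, so the normalizing sum is at least half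
  -- of `T`.
  have h2 : (1 - 1 / ((K : ℝ) * R)) ^ (K * R) ≤ 1 / 2 := by
    have h3 : 1 - 1 / ((K : ℝ) * R) ≤ Real.exp (-(1 / (K * R))) := Real.one_sub_le_exp_neg _
    calc (1 - 1 / ((K : ℝ) * R)) ^ (K * R)
        ≤ Real.exp (-(1 / ((K : ℝ) * R))) ^ (K * R) :=
          pow_le_pow_left₀ (geomRatio_nonneg hK hR) h3 _
      _ = Real.exp (-1) := by
          rw [← Real.exp_nat_mul]
          congr 1
          push_cast
          field_simp
      _ ≤ 1 / 2 := by
          rw [Real.exp_neg, one_div]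
          gcongr
          have := Real.add_one_le_exp 1
          linarith
  set S := ∑ i ∈ Finset.range (K * R), (1 - 1 / ((K : ℝ) * R)) ^ i
  have h4 : S = (K * R) * (1 - (1 - 1 / ((K : ℝ) * R)) ^ (K * R)) := by
    rw [← neg_sub _ (1 : ℝ), ← h1]
    field_simp
    ring
  rw [h4]
  nlinarith

theorem geomWeight_nonneg (hK : 0 < K) (hR : 0 < R) (r k : ℕ) : 0 ≤ geomWeight K R r k := by
  have hT : (0 : ℝ) < K * R := by positivity
  have h1 := half_mul_le_geom_sum hK hR
  exact div_nonneg (pow_nonneg (geomRatio_nonneg hK hR) _) (by linarith)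

theorem geomWeight_le (hK : 0 < K) (hR : 0 < R) (r k : ℕ) :
    geomWeight K R r k ≤ 2 / (K * R) := by
  have hT : (0 : ℝ) < K * R := by positivity
  have h1 := half_mul_le_geom_sum hK hR
  have h2 : (1 - 1 / ((K : ℝ) * R)) ^ (K * r + k) ≤ 1 :=
    pow_le_one₀ (geomRatio_nonneg hK hR) (by linarith [one_div_pos.2 hT])
  calc geomWeight K R r k ≤ 1 / (K * R / 2) := by
        unfold geomWeight
        gcongr
    _ = 2 / (K * R) := by field_simp

theorem sum_range_mul_add (g : ℕ → ℝ) (K R : ℕ) :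
    ∑ r ∈ Finset.range R, ∑ k ∈ Finset.range K, g (K * r + k)
      = ∑ i ∈ Finset.range (K * R), g i := by
  induction R with
  | zero => simp
  | succ R ih => rw [Finset.sum_range_succ, ih, Nat.mul_succ, Finset.sum_range_add]

theorem sum_geomWeight (hK : 0 < K) (hR : 0 < R) :
    ∑ r ∈ Finset.range R, ∑ k ∈ Finset.range K, geomWeight K R r k = 1 := by
  have hT : (0 : ℝ) < K * R := by positivity
  have h1 := half_mul_le_geom_sum hK hR
  simp only [geomWeight, ← Finset.sum_div]
  rw [sum_range_mul_add fun i => (1 - 1 / ((K : ℝ) * R)) ^ i]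
  exact div_self (by linarith)

end Weights

/-! ### From the iterates to the output -/

section Convergence

variable {d M K R : ℕ} {Ξ : Type v} [MeasurableSpace Ξ] {D : Fin M → Measure Ξ}
  [∀ m, IsProbabilityMeasure (D m)] {f : Param d → Ξ → ℝ} {H : ℝ≥0} {Fstar : ℝ}

/-- Jensen, then each weight is replaced by its upper bound. The replacement needs nonnegative
summands, hence gaps to `Fstar`: gaps to `F(u)` may be negative. -/
theorem globalObj_output_sub_le (hK : 0 < K) (hR : 0 < R)
    (h : IsConvexSmoothObjective D f H Fstar) (η : ℝ) (x : ℕ → ℕ → Fin M → Ξ) (w₀ : Param d) :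
    globalObj D f (output f η K R (geomWeight K R) x w₀) - Fstar
      ≤ 2 / (K * R) * ∑ r ∈ Finset.range R, ∑ k ∈ Finset.range K,
        (globalObj D f (averageIter f η K x w₀ r k) - Fstar) := by
  have hsum : ∑ p ∈ Finset.range R ×ˢ Finset.range K, geomWeight K R p.1 p.2 = 1 := by
    rw [Finset.sum_product]
    exact sum_geomWeight hK hR
  have hout : output f η K R (geomWeight K R) x w₀
      = ∑ p ∈ Finset.range R ×ˢ Finset.range K,
        geomWeight K R p.1 p.2 • averageIter f η K x w₀ p.1 p.2 := by
    rw [Finset.sum_product]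
    rfl
  have h1 := h.convexOn_globalObj.map_sum_le (t := Finset.range R ×ˢ Finset.range K)
    (w := fun p => geomWeight K R p.1 p.2) (p := fun p => averageIter f η K x w₀ p.1 p.2)
    (fun p _ => geomWeight_nonneg hK hR _ _) hsum (fun p _ => Set.mem_univ _)
  rw [← hout] at h1
  have h2 : ∑ p ∈ Finset.range R ×ˢ Finset.range K,
      geomWeight K R p.1 p.2 • globalObj D f (averageIter f η K x w₀ p.1 p.2) - Fstar
      = ∑ p ∈ Finset.range R ×ˢ Finset.range K,
        geomWeight K R p.1 p.2 * (globalObj D f (averageIter f η K x w₀ p.1 p.2) - Fstar) := by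
    simp_rw [mul_sub, Finset.sum_sub_distrib, ← Finset.sum_mul, hsum, one_mul, smul_eq_mul]
  rw [← Finset.sum_product' (f := fun r k => globalObj D f (averageIter f η K x w₀ r k) - Fstar),
    Finset.mul_sum]
  refine (sub_le_sub_right h1 _).trans (h2.le.trans (Finset.sum_le_sum fun p _ => ?_))
  exact mul_le_mul_of_nonneg_right (geomWeight_le hK hR _ _) (sub_nonneg.2 (h.lower_bound _))

/-- The convergence bound for an arbitrary admissible step size. -/
theorem expected_suboptimality_le {Ω : Type*} [MeasurableSpace Ω] {P : Measure Ω}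
    [IsProbabilityMeasure P] {ξ : ℕ → ℕ → Fin M → Ω → Ξ} {u : Param d} {σ ζ : ℝ}
    (hM : 0 < M) (hK : 0 < K) (hR : 0 < R)
    (h : IsConvexSmoothObjective D f H Fstar) (hσ : LocalNoise D f u σ)
    (hζ : LocalHeterogeneity D f u ζ) (hξ : IsSampling D K R P ξ) {η : ℝ} (hη : 0 < η)
    (hηH : 6 * (η * K) * H ≤ 1) (w₀ : Param d) :
    Integrable (fun ω => globalObj D f
      (output f η K R (geomWeight K R) (fun r k m => ξ r k m ω) w₀)) P ∧
    ∫ ω, (globalObj D f (output f η K R (geomWeight K R) (fun r k m => ξ r k m ω) w₀)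
        - Fstar) ∂P
      ≤ ‖w₀ - u‖ ^ 2 / (η * (K * R)) + 3 * (η * (σ ^ 2 / M)) + 3 * (η ^ 2 * (H * K * σ ^ 2))
        + 6 * (η ^ 2 * (H * K ^ 2 * ζ ^ 2)) + 10 * (globalObj D f u - Fstar) := by
  have hT : (0 : ℝ) < K * R := by positivity
  let X : ℕ → ℕ → Ω → Param d := fun r k ω =>
    averageIter f η K (fun r k m => ξ r k m ω) w₀ r k
  let W : Ω → Param d := fun ω => output f η K R (geomWeight K R) (fun r k m => ξ r k m ω) w₀
  have hX : ∀ r ∈ Finset.range R, ∀ k ∈ Finset.range K, MemLp (X r k) 2 P := fun r hr k hk =>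
    memLp_averageIter h hσ hξ η w₀ (Finset.mem_range.1 hr) (Finset.mem_range.1 hk).le
  have hFX : ∀ r ∈ Finset.range R, ∀ k ∈ Finset.range K,
      Integrable (fun ω => globalObj D f (X r k ω)) P := fun r hr k hk =>
    (integral_average_comp_sub h hσ hξ (Finset.mem_range.1 hr) (Finset.mem_range.1 hk)
      (hX r hr k hk) (measurable_averageIter h η w₀ (Finset.mem_range.1 hr)
        (Finset.mem_range.1 hk))).2.1
  have hFXs : ∀ c : ℝ, ∀ r ∈ Finset.range R, ∀ k ∈ Finset.range K,
      Integrable (fun ω => globalObj D f (X r k ω) - c) P := fun c r hr k hk =>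
    (hFX r hr k hk).sub (integrable_const _)
  have hbound : Integrable (fun ω => 2 / ((K : ℝ) * R) * ∑ r ∈ Finset.range R,
      ∑ k ∈ Finset.range K, (globalObj D f (X r k ω) - Fstar)) P :=
    (integrable_finsetSum _ fun r hr => integrable_finsetSum _ fun k hk =>
      hFXs Fstar r hr k hk).const_mul _
  have hWm : AEStronglyMeasurable W P :=
    (memLp_finsetSum _ fun r hr => memLp_finsetSum _ fun k hk =>
      (hX r hr k hk).const_smul (geomWeight K R r k)).1
  have hle : ∀ ω, globalObj D f (W ω) - Fstar ≤ 2 / ((K : ℝ) * R) * ∑ r ∈ Finset.range R,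
      ∑ k ∈ Finset.range K, (globalObj D f (X r k ω) - Fstar) := fun ω =>
    globalObj_output_sub_le hK hR h η _ w₀
  have hsub : Integrable (fun ω => globalObj D f (W ω) - Fstar) P := by
    refine hbound.mono' ((h.differentiable_globalObj.continuous.comp_aestronglyMeasurable
      hWm).sub aestronglyMeasurable_const) (Filter.Eventually.of_forall fun ω => ?_)
    rw [Real.norm_of_nonneg (sub_nonneg.2 (h.lower_bound _))]
    exact hle ω
  refine ⟨(hsub.add (integrable_const Fstar)).congr
    (Filter.Eventually.of_forall fun ω => sub_add_cancel _ _), ?_⟩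
  refine (integral_mono hsub hbound hle).trans ?_
  have hmain := expected_total_inequality hM hK h hσ hζ hξ hη.le hηH w₀
  -- Passing from gaps to `Fstar` to gaps to `F(u)` costs `2 * Δ` after weighting, which with `2 *
  -- (4 * Δ)` from `Q` gives the constant 10.
  have hshift : ∑ r ∈ Finset.range R, ∑ k ∈ Finset.range K,
      ∫ ω, (globalObj D f (X r k ω) - Fstar) ∂P
      = ∑ r ∈ Finset.range R, ∑ k ∈ Finset.range K,
        ∫ ω, (globalObj D f (X r k ω) - globalObj D f u) ∂P
        + K * R * (globalObj D f u - Fstar) := by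
    have h1 : ∀ r ∈ Finset.range R, ∀ k ∈ Finset.range K,
        ∫ ω, (globalObj D f (X r k ω) - Fstar) ∂P
        = ∫ ω, (globalObj D f (X r k ω) - globalObj D f u) ∂P
          + (globalObj D f u - Fstar) := by
      intro r hr k hk
      rw [integral_sub (hFX r hr k hk) (integrable_const _),
        integral_sub (hFX r hr k hk) (integrable_const _), integral_const, integral_const,
        probReal_univ, one_smul, one_smul]
      ring
    rw [Finset.sum_congr rfl fun r hr => Finset.sum_congr rfl fun k hk => h1 r hr k hk]
    simp only [Finset.sum_add_distrib, Finset.sum_const, Finset.card_range, nsmul_eq_mul]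
    ring
  rw [integral_const_mul, integral_finsetSum _ fun r hr => integrable_finsetSum _ fun k hk =>
    hFXs Fstar r hr k hk, Finset.sum_congr rfl fun r hr => integral_finsetSum _ fun k hk =>
    hFXs Fstar r hr k hk, hshift]
  set S := ∑ r ∈ Finset.range R, ∑ k ∈ Finset.range K,
        ∫ ω, (globalObj D f (X r k ω) - globalObj D f u) ∂P
  set Δ := globalObj D f u - Fstar
  set Q := 3 / 2 * (η * (σ ^ 2 / M)) + 3 / 2 * (η ^ 2 * (H * K * σ ^ 2))
    + 3 * (η ^ 2 * (H * K ^ 2 * ζ ^ 2)) + 4 * Δ with hQ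
  have hS : S ≤ (‖w₀ - u‖ ^ 2 + 2 * η * (K * R) * Q) / (2 * η) := by
    rw [le_div_iff₀ (by positivity), mul_comm]
    exact hmain
  calc 2 / ((K : ℝ) * R) * (S + K * R * Δ)
      ≤ 2 / ((K : ℝ) * R) * ((‖w₀ - u‖ ^ 2 + 2 * η * (K * R) * Q) / (2 * η) + K * R * Δ) := by
        gcongr
    _ = ‖w₀ - u‖ ^ 2 / (η * (K * R)) + 2 * Q + 2 * Δ := by field_simp
    _ = _ := by rw [hQ]; ring

end Convergence

/-! ### The zero step size -/

section Start

variable {d M K R : ℕ} {Ξ : Type v} {f : Param d → Ξ → ℝ}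

theorem localIter_stepSize_zero (x : ℕ → Ξ) (w : Param d) (k : ℕ) :
    localIter f 0 x w k = w := by
  induction k with
  | zero => rfl
  | succ k ih => rw [localIter, ih, zero_smul, sub_zero]

theorem average_const (hM : 0 < M) (w : Param d) :
    (1 / (M : ℝ)) • ∑ _m : Fin M, w = w := by
  rw [Finset.sum_const, Finset.card_univ, Fintype.card_fin, ← Nat.cast_smul_eq_nsmul ℝ, smul_smul,
    one_div_mul_cancel (by positivity), one_smul]

theorem output_stepSize_zero (hM : 0 < M) (hK : 0 < K) (hR : 0 < R) (x : ℕ → ℕ → Fin M → Ξ)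
    (w : Param d) : output f 0 K R (geomWeight K R) x w = w := by
  have hs : ∀ r, syncIter f 0 K x w r = w := by
    intro r
    induction r with
    | zero => rfl
    | succ r ih =>
      rw [syncIter, ih]
      simp_rw [localIter_stepSize_zero]
      exact average_const hM w
  simp only [output, clientIter, hs, localIter_stepSize_zero, average_const hM, ← Finset.sum_smul]
  rw [sum_geomWeight hK hR, one_smul]

end Start

/-! ### Choice of the step size -/

section StepSize

/-- The step size that balances the terms of the convergence bound. -/
theorem exists_balanced_stepSize {H B σ ζ M K R : ℝ} (hH : 0 < H) (hB : 0 < B) (hσ : 0 ≤ σ)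
    (hM : 0 < M) (hK : 0 < K) (hR : 0 < R) :
    ∃ η : ℝ, 0 < η ∧ 6 * (η * K) * H ≤ 1 ∧
      B ^ 2 / (η * (K * R)) + 3 * (η * (σ ^ 2 / M)) + 3 * (η ^ 2 * (H * K * σ ^ 2))
        + 6 * (η ^ 2 * (H * K ^ 2 * ζ ^ 2))
      ≤ 7 * (H * B ^ 2 / R + σ * B / √(M * K * R)
          + (H * σ ^ 2 * B ^ 4) ^ (1 / 3 : ℝ) / (K ^ (1 / 3 : ℝ) * R ^ (2 / 3 : ℝ))
          + (H * ζ ^ 2 * B ^ 4) ^ (1 / 3 : ℝ) / R ^ (2 / 3 : ℝ)) := by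
  have cube : ∀ x : ℝ, 0 ≤ x → (x ^ (1 / 3 : ℝ)) ^ 3 = x := by
    intro x hx
    rw [← Real.rpow_natCast, ← Real.rpow_mul hx]
    norm_num
  -- Naming the cube roots turns the fractional powers into integer powers, so `field_simp` and
  -- `ring` can verify the balance.
  obtain ⟨p, hp⟩ : ∃ p, p = (H * σ ^ 2) ^ (1 / 3 : ℝ) := ⟨_, rfl⟩
  obtain ⟨p', hp'⟩ : ∃ p, p = (H * ζ ^ 2) ^ (1 / 3 : ℝ) := ⟨_, rfl⟩
  obtain ⟨q, hq⟩ : ∃ q, q = B ^ (1 / 3 : ℝ) := ⟨_, rfl⟩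
  obtain ⟨k, hk⟩ : ∃ k, k = K ^ (1 / 3 : ℝ) := ⟨_, rfl⟩
  obtain ⟨ρ, hρ⟩ : ∃ ρ, ρ = R ^ (1 / 3 : ℝ) := ⟨_, rfl⟩
  have hp0 : 0 ≤ p := by rw [hp]; positivity
  have hp0' : 0 ≤ p' := by rw [hp']; positivity
  have hq0 : 0 < q := by rw [hq]; positivity
  have hk0 : 0 < k := by rw [hk]; positivity
  have hρ0 : 0 < ρ := by rw [hρ]; positivity
  have hp3 : H * σ ^ 2 = p ^ 3 := by rw [hp, cube _ (by positivity)]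
  have hp3' : H * ζ ^ 2 = p' ^ 3 := by rw [hp', cube _ (by positivity)]
  have hq3 : B = q ^ 3 := by rw [hq, cube _ hB.le]
  have hk3 : K = k ^ 3 := by rw [hk, cube _ hK.le]
  have hρ3 : R = ρ ^ 3 := by rw [hρ, cube _ hR.le]
  have hq4 : (B ^ 4) ^ (1 / 3 : ℝ) = q ^ 4 := by
    rw [hq, ← Real.rpow_natCast, ← Real.rpow_natCast, ← Real.rpow_mul hB.le,
      ← Real.rpow_mul hB.le, mul_comm]
  have hρ2 : R ^ (2 / 3 : ℝ) = ρ ^ 2 := by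
    rw [hρ, ← Real.rpow_natCast, ← Real.rpow_mul hR.le]
    norm_num
  obtain ⟨s, hs⟩ : ∃ s, s = √(M * K * R) := ⟨_, rfl⟩
  have hs0 : 0 < s := by rw [hs]; positivity
  have hs2 : s ^ 2 = M * K * R := by rw [hs, Real.sq_sqrt (by positivity)]
  rw [Real.mul_rpow (x := H * σ ^ 2) (by positivity) (by positivity),
    Real.mul_rpow (x := H * ζ ^ 2) (by positivity) (by positivity), ← hp, ← hp', hq4, hρ2, ← hk, ← hs]
  -- Reciprocal step sizes: `1 / a` is the stability limit, and at `1 / b`, `1 / c`, `1 / e` (when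
  -- nonzero) the term `B ^ 2 / (η * (K * R))` equals one of the error terms. Adding reciprocals
  -- allows `σ` or `ζ` to vanish, and makes that term exactly `6 * X₁ + X₂ + X₃ + X₄`.
  obtain ⟨a, ha⟩ : ∃ a, a = 6 * K * H := ⟨_, rfl⟩
  obtain ⟨b, hb⟩ : ∃ b, b = σ * s / (B * M) := ⟨_, rfl⟩
  obtain ⟨c, hc⟩ : ∃ c, c = p * k ^ 2 * ρ / q ^ 2 := ⟨_, rfl⟩
  obtain ⟨e, he⟩ : ∃ e, e = p' * k ^ 3 * ρ / q ^ 2 := ⟨_, rfl⟩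
  have ha0 : 0 < a := by rw [ha]; positivity
  have hb0 : 0 ≤ b := by rw [hb]; positivity
  have hc0 : 0 ≤ c := by rw [hc]; positivity
  have he0 : 0 ≤ e := by rw [he]; positivity
  have hL : 0 < a + b + c + e := by positivity
  set X₁ := H * B ^ 2 / R with hX₁
  set X₂ := σ * B / s with hX₂
  set X₃ := p * q ^ 4 / (k * ρ ^ 2) with hX₃
  set X₄ := p' * q ^ 4 / ρ ^ 2 with hX₄
  have hX₁0 : 0 ≤ X₁ := by positivity
  have hX₂0 : 0 ≤ X₂ := by positivity
  have hX₃0 : 0 ≤ X₃ := by positivity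
  have hX₄0 : 0 ≤ X₄ := by positivity
  obtain ⟨η, hη⟩ : ∃ η, η = 1 / (a + b + c + e) := ⟨_, rfl⟩
  have hη0 : 0 < η := by rw [hη]; positivity
  have hηL : η * (a + b + c + e) = 1 := by rw [hη]; field_simp
  have hηle : ∀ y ≤ a + b + c + e, η * y ≤ 1 := fun y hy =>
    (mul_le_mul_of_nonneg_left hy hη0.le).trans hηL.le
  have hηa : η * a ≤ 1 := hηle a (by linarith)
  have hηb : η * b ≤ 1 := hηle b (by linarith)
  have hηc : η * c ≤ 1 := hηle c (by linarith)
  have hηe : η * e ≤ 1 := hηle e (by linarith)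
  have i1 : B ^ 2 / (η * (K * R)) = 6 * X₁ + X₂ + X₃ + X₄ := by
    have h1 : B ^ 2 / (η * (K * R)) = B ^ 2 * (a + b + c + e) / (K * R) := by
      rw [hη]; field_simp
    have e1 : B ^ 2 * a / (K * R) = 6 * X₁ := by rw [ha, hX₁]; field_simp
    have e2 : B ^ 2 * b / (K * R) = X₂ := by
      rw [hb, hX₂]
      field_simp
      rw [hs2]; ring
    have e3 : B ^ 2 * c / (K * R) = X₃ := by
      rw [hc, hX₃, hq3, hk3, hρ3]
      field_simp
    have e4 : B ^ 2 * e / (K * R) = X₄ := by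
      rw [he, hX₄, hq3, hk3, hρ3]
      field_simp
    rw [h1, ← e1, ← e2, ← e3, ← e4]
    ring
  have i2 : η * (σ ^ 2 / M) ≤ X₂ := by
    have e2 : η * (σ ^ 2 / M) = (η * b) * X₂ := by rw [hb, hX₂]; field_simp
    rw [e2]
    exact mul_le_of_le_one_left hX₂0 hηb
  have i3 : η ^ 2 * (H * K * σ ^ 2) ≤ X₃ := by
    have e3 : η ^ 2 * (H * K * σ ^ 2) = (η * c) ^ 2 * X₃ := by
      have : H * K * σ ^ 2 = p ^ 3 * k ^ 3 := by rw [← hp3, ← hk3]; ring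
      rw [this, hc, hX₃]; field_simp
    rw [e3]
    exact mul_le_of_le_one_left hX₃0 (pow_le_one₀ (by positivity) hηc)
  have i4 : η ^ 2 * (H * K ^ 2 * ζ ^ 2) ≤ X₄ := by
    have e4 : η ^ 2 * (H * K ^ 2 * ζ ^ 2) = (η * e) ^ 2 * X₄ := by
      have : H * K ^ 2 * ζ ^ 2 = p' ^ 3 * (k ^ 3) ^ 2 := by rw [← hp3', ← hk3]; ring
      rw [this, he, hX₄]; field_simp
    rw [e4]
    exact mul_le_of_le_one_left hX₄0 (pow_le_one₀ (by positivity) hηe)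
  refine ⟨η, hη0, ?_, ?_⟩
  · rw [ha] at hηa
    linarith
  · rw [i1]
    linarith

/-- A step size whose error terms are dominated by a prescribed positive gap. -/
theorem exists_small_stepSize {H Δ σ ζ M K : ℝ} (hH : 0 < H) (hΔ : 0 < Δ) (hM : 1 ≤ M)
    (hK : 0 < K) :
    ∃ η : ℝ, 0 < η ∧ 6 * (η * K) * H ≤ 1 ∧
      3 * (η * (σ ^ 2 / M)) + 3 * (η ^ 2 * (H * K * σ ^ 2)) + 6 * (η ^ 2 * (H * K ^ 2 * ζ ^ 2))
        ≤ 2 * Δ := by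
  have hL : 0 < 2 * σ ^ 2 + K * ζ ^ 2 + 1 := by positivity
  -- By the first bound the two quadratic terms are at most `η * σ ^ 2 / 2` and `η * K * ζ ^ 2`; the
  -- second then suffices. The summand 1 keeps the denominator positive when `σ = ζ = 0`.
  obtain ⟨η, hη⟩ : ∃ η, η = min (1 / (6 * K * H)) (Δ / (2 * σ ^ 2 + K * ζ ^ 2 + 1)) := ⟨_, rfl⟩
  have hη0 : 0 < η := by rw [hη]; positivity
  have h1 : η * (6 * K * H) ≤ 1 := by
    rw [← le_div_iff₀ (by positivity), hη]; exact min_le_left _ _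
  have h2 : η * (2 * σ ^ 2 + K * ζ ^ 2 + 1) ≤ Δ := by
    rw [← le_div_iff₀ hL, hη]; exact min_le_right _ _
  refine ⟨η, hη0, by linarith, ?_⟩
  have i1 : η * (σ ^ 2 / M) ≤ η * σ ^ 2 := by
    gcongr
    exact div_le_self (sq_nonneg _) hM
  have i2 := mul_le_mul_of_nonneg_left h1 (by positivity : 0 ≤ η * σ ^ 2)
  have i3 := mul_le_mul_of_nonneg_left h1 (by positivity : 0 ≤ η * (K * ζ ^ 2))
  have i4 : 0 ≤ η * σ ^ 2 := by positivity
  have i5 : 0 ≤ η * (K * ζ ^ 2) := by positivity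
  linarith

end StepSize

end LocalSGD

/-! ### Assembly of the cases -/

theorem theorem5 :
    ∃ C : ℝ, 0 < C ∧
      ∀ (d M K R : ℕ), 0 < M → 0 < K → 0 < R →
      ∀ (Ξ : Type*) [MeasurableSpace Ξ] (D : Fin M → Measure Ξ) [∀ m, IsProbabilityMeasure (D m)]
        (f : LocalSGD.Param d → Ξ → ℝ) (H : ℝ≥0) (Fstar : ℝ),
        LocalSGD.IsConvexSmoothObjective D f H Fstar →
      ∀ (w₀ u : LocalSGD.Param d) (σ ζ : ℝ),
        LocalSGD.LocalNoise D f u σ → LocalSGD.LocalHeterogeneity D f u ζ →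
      ∃ η : ℝ, 0 ≤ η ∧ (η = 0 → w₀ = u ∧ LocalSGD.globalObj D f u = Fstar) ∧
        ∀ (Ω : Type*) [MeasurableSpace Ω] (P : Measure Ω) [IsProbabilityMeasure P]
          (ξ : ℕ → ℕ → Fin M → Ω → Ξ), LocalSGD.IsSampling D K R P ξ →
        Integrable (fun ω => LocalSGD.globalObj D f
          (LocalSGD.output f η K R (LocalSGD.geomWeight K R) (fun r k m => ξ r k m ω) w₀)) P ∧
        ∫ ω, (LocalSGD.globalObj D f
          (LocalSGD.output f η K R (LocalSGD.geomWeight K R) (fun r k m => ξ r k m ω) w₀)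
            - Fstar) ∂P ≤
          C * (H * ‖w₀ - u‖ ^ 2 / R
            + σ * ‖w₀ - u‖ / √(M * K * R)
            + (H * σ ^ 2 * ‖w₀ - u‖ ^ 4) ^ (1 / 3 : ℝ)
                / ((K : ℝ) ^ (1 / 3 : ℝ) * (R : ℝ) ^ (2 / 3 : ℝ))
            + (H * ζ ^ 2 * ‖w₀ - u‖ ^ 4) ^ (1 / 3 : ℝ) / (R : ℝ) ^ (2 / 3 : ℝ)
            + R * (LocalSGD.globalObj D f u - Fstar)) := by
  -- 12 is reached when `w₀ = u`: `10 * Δ` from the general bound and `2 * Δ` from the small step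
  -- size.
  refine ⟨12, by norm_num, ?_⟩
  intro d M K R hM hK hR Ξ _ D _ f H Fstar h w₀ u σ ζ hσ hζ
  have hΔ : 0 ≤ LocalSGD.globalObj D f u - Fstar := sub_nonneg.2 (h.lower_bound u)
  have hR1 : (1 : ℝ) ≤ R := by exact_mod_cast hR
  have hM1 : (1 : ℝ) ≤ M := by exact_mod_cast hM
  have hK0 : (0 : ℝ) < K := by exact_mod_cast hK
  have hRΔ := mul_le_mul_of_nonneg_right hR1 hΔ
  have hX : 0 ≤ H * ‖w₀ - u‖ ^ 2 / R
            + σ * ‖w₀ - u‖ / √(M * K * R)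
            + (H * σ ^ 2 * ‖w₀ - u‖ ^ 4) ^ (1 / 3 : ℝ)
                / ((K : ℝ) ^ (1 / 3 : ℝ) * (R : ℝ) ^ (2 / 3 : ℝ))
            + (H * ζ ^ 2 * ‖w₀ - u‖ ^ 4) ^ (1 / 3 : ℝ) / (R : ℝ) ^ (2 / 3 : ℝ) := by
    have := hσ.1
    positivity
  rcases eq_or_ne H 0 with rfl | hH
  -- When `H = 0` the global objective is constant, so any positive step size works.
  · refine ⟨1, zero_le_one, fun h1 => absurd h1 one_ne_zero, ?_⟩
    intro Ω _ P _ ξ hξ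
    simp only [fun w => h.globalObj_eq_of_smoothness_zero hM w u]
    refine ⟨integrable_const _, ?_⟩
    rw [integral_const, probReal_univ, one_smul]
    linarith
  have hH0 : (0 : ℝ) < H := by positivity
  rcases eq_or_ne w₀ u with rfl | hw
  · rcases hΔ.eq_or_lt with hΔ0 | hΔ0
    · have hFu : LocalSGD.globalObj D f w₀ = Fstar := by linarith
      -- The bound may be zero here, even with noisy gradients, so the iterates are kept at the
      -- optimal starting point.
      refine ⟨0, le_rfl, fun _ => ⟨rfl, hFu⟩, ?_⟩
      intro Ω _ P _ ξ hξ
      simp only [LocalSGD.output_stepSize_zero hM hK hR]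
      refine ⟨integrable_const _, ?_⟩
      rw [integral_const, probReal_univ, one_smul]
      linarith
    · obtain ⟨η, hη, hηH, hb⟩ := LocalSGD.exists_small_stepSize (σ := σ) (ζ := ζ) hH0 hΔ0 hM1 hK0
      refine ⟨η, hη.le, fun h0 => absurd h0 hη.ne', ?_⟩
      intro Ω _ P _ ξ hξ
      obtain ⟨h1, h2⟩ := LocalSGD.expected_suboptimality_le hM hK hR h hσ hζ hξ hη hηH w₀
      refine ⟨h1, h2.trans ?_⟩
      have h3 : ‖w₀ - w₀‖ ^ 2 / (η * (K * R)) = 0 := by simp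
      rw [h3]
      linarith
  · obtain ⟨η, hη, hηH, hb⟩ := LocalSGD.exists_balanced_stepSize (ζ := ζ) hH0
      (norm_pos_iff.2 (sub_ne_zero.2 hw)) hσ.1 (by linarith : (0 : ℝ) < M) hK0
      (by linarith : (0 : ℝ) < R)
    refine ⟨η, hη.le, fun h0 => absurd h0 hη.ne', ?_⟩
    intro Ω _ P _ ξ hξ
    obtain ⟨h1, h2⟩ := LocalSGD.expected_suboptimality_le hM hK hR h hσ hζ hξ hη hηH w₀
    refine ⟨h1, h2.trans ?_⟩
    linarith
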